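/- For a language $L\subseteq\Sigma^*$ let $\mathrm{pref}(L)$, $\mathrm{suff}(L)$ and $\mathrm{fact}(L)$ be the languages of all prefixes, all suffixes and all factors (contiguous subwords) of words of $L$. Call $L$ prefix-closed if $L=\mathrm{pref}(L)$, suffix-closed if $L=\mathrm{suff}(L)$, and factorial if $L=\mathrm{fact}(L)$. A deterministic finite automaton (DFA) $M$ with state set $\{0,\dots,n-1\}$, input alphabet $\{0,\dots,k-1\}$, one start state, a total transition function and a set of final states ($n\ge 1$ and $k\ge 0$ being part of the input) is given as a bit string that lists $k$, $n$, the start state and, for each state, whether it is final and its row of the transition table, where a number $i$ is written $1^i0$. (The length of this description is polynomially bounded in $n(k+1)$.) Theorem. Each of the following three problems can be solved in polynomial time, that is, there is a multi-tape Turing machine which, on the description of any DFA $M$, halts with the correct answer within a number of steps bounded by a polynomial in the length of the description: (a) given a DFA $M$, decide whether $L(M)$ is not prefix-closed; (b) given a DFA $M$, decide whether $L(M)$ is not suffix-closed; (c) given a DFA $M$, decide whether $L(M)$ is not factorial. -/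

import Mathlib

namespace DFAClosure

section Languages

variable {α : Type*}

/-- `pref L`: all prefixes of words of `L`. -/
def pref (L : Language α) : Language α := {x | ∃ w ∈ L, x <+: w}

/-- `suff L`: all suffixes of words of `L`. -/
def suff (L : Language α) : Language α := {x | ∃ w ∈ L, x <:+ w}

/-- `fact L`: all factors (contiguous subwords) of words of `L`. -/
def fact (L : Language α) : Language α := {x | ∃ w ∈ L, x <:+: w}

/-- `L` is prefix-closed if `L = pref L`. -/
def IsPrefixClosed (L : Language α) : Prop := L = pref L

/-- `L` is suffix-closed if `L = suff L`. -/
def IsSuffixClosed (L : Language α) : Prop := L = suff L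

/-- `L` is factorial if `L = fact L`. -/
def IsFactorial (L : Language α) : Prop := L = fact L

end Languages

/-- A problem instance: a (complete) DFA whose states are `0, …, numStates - 1` and whose input
alphabet is `{0, …, numLetters - 1}`. Both numbers are part of the instance. -/
structure FiniteDFA where
  numLetters : ℕ
  numStates : ℕ
  dfa : DFA (Fin numLetters) (Fin numStates)

/-- The language accepted by the automaton. -/
def FiniteDFA.lang (M : FiniteDFA) : Language (Fin M.numLetters) := M.dfa.accepts

/-- The self-delimiting code `1ⁱ0` of a natural number `i`. -/
def unary (i : ℕ) : List Bool := List.replicate i true ++ [false]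

open Classical in
/-- The description of a DFA as a bit string: the number of letters, the number of states, the
start state, and then, for each state `q` in turn, one bit telling whether `q` is final, followed by
the row of the transition table that belongs to `q`. Its length is polynomially bounded in the
number of entries of the transition table and the number of states (`FiniteDFA.length_encode_le`),
and any listing of the transition table and of the final states is at least that number long, so
this description is polynomially related to the one with numbers written in binary. -/
noncomputable def FiniteDFA.encode (M : FiniteDFA) : List Bool :=
  unary M.numLetters ++ (unary M.numStates ++ (unary M.dfa.start ++
    (List.finRange M.numStates).flatMap fun q =>
      decide (q ∈ M.dfa.accept) ::
        (List.finRange M.numLetters).flatMap fun a => unary (M.dfa.step q a)))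

theorem unary_append_inj {i j : ℕ} {s t : List Bool} (h : unary i ++ s = unary j ++ t) :
    i = j ∧ s = t := by
  induction i generalizing j with
  | zero => cases j <;> simp_all [unary, List.replicate_succ]
  | succ i ih =>
    cases j with
    | zero => simp [unary, List.replicate_succ] at h
    | succ j =>
      have := @ih j (by simpa [unary, List.replicate_succ] using h)
      simpa using this

theorem flatMap_append_inj {ι β : Type} {f g : ι → List β} {P : ι → Prop}
    (hP : ∀ x s t, f x ++ s = g x ++ t → P x ∧ s = t) (l : List ι) :
    ∀ s t, l.flatMap f ++ s = l.flatMap g ++ t → (∀ x ∈ l, P x) ∧ s = t := by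
  induction l with
  | nil => intro s t h; simpa using h
  | cons y l ih =>
    intro s t h
    simp only [List.flatMap_cons, List.append_assoc] at h
    obtain ⟨h1, h2⟩ := hP y _ _ h
    obtain ⟨h3, h4⟩ := ih _ _ h2
    exact ⟨by simpa using ⟨h1, h3⟩, h4⟩

/-- Different automata have different descriptions. -/
theorem FiniteDFA.encode_injective : Function.Injective FiniteDFA.encode := by
  classical
  rintro ⟨k, n, M⟩ ⟨k', n', M'⟩ h
  simp only [FiniteDFA.encode] at h
  obtain ⟨rfl, h⟩ := unary_append_inj h
  obtain ⟨rfl, h⟩ := unary_append_inj h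
  obtain ⟨hs, h⟩ := unary_append_inj h
  have key := flatMap_append_inj
    (f := fun q => decide (q ∈ M.accept) ::
      (List.finRange k).flatMap fun a => unary (M.step q a))
    (g := fun q => decide (q ∈ M'.accept) ::
      (List.finRange k).flatMap fun a => unary (M'.step q a))
    (P := fun q => (q ∈ M.accept ↔ q ∈ M'.accept) ∧ ∀ a, M.step q a = M'.step q a)
    (fun q s t hq => by
      simp only [List.cons_append, List.cons.injEq, decide_eq_decide] at hq
      obtain ⟨h1, h2⟩ := flatMap_append_inj
        (f := fun a => unary (M.step q a)) (g := fun a => unary (M'.step q a))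
        (P := fun a => M.step q a = M'.step q a)
        (fun a s t ha => by
          obtain ⟨h1, h2⟩ := unary_append_inj ha
          exact ⟨Fin.ext h1, h2⟩) _ _ _ hq.2
      exact ⟨⟨hq.1, fun a => h1 a (List.mem_finRange a)⟩, h2⟩)
    (List.finRange n) [] [] (by
      rw [List.append_nil, List.append_nil]
      convert h)
  have hM : M = M' := by
    cases M; cases M'
    simp only [DFA.mk.injEq]
    exact ⟨funext fun q => funext fun a => (key.1 q (List.mem_finRange q)).2 a, Fin.ext hs,
      Set.ext fun q => (key.1 q (List.mem_finRange q)).1⟩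
  rw [hM]

theorem length_flatMap_le {ι β : Type} {f : ι → List β} {c : ℕ} (hf : ∀ x, (f x).length ≤ c)
    (l : List ι) : (l.flatMap f).length ≤ l.length * c := by
  induction l with
  | nil => simp
  | cons y l ih =>
    simp only [List.flatMap_cons, List.length_append, List.length_cons]
    linarith [hf y]

/-- The length of the description is at most quadratic in the number of transitions plus the number
of states. -/
theorem FiniteDFA.length_encode_le (M : FiniteDFA) :
    M.encode.length ≤ 6 * (M.numStates * (M.numLetters + 1)) ^ 2 := by
  classical
  obtain ⟨k, n, M⟩ := M
  have hu : ∀ i, (unary i).length = i + 1 := fun i => by simp [unary]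
  have hs : (M.start : ℕ) < n := M.start.isLt
  have h1 := length_flatMap_le (c := 1 + k * n) (f := fun q =>
      decide (q ∈ M.accept) :: (List.finRange k).flatMap fun a => unary (M.step q a))
    (fun q => by
      have := length_flatMap_le (c := n) (f := fun a => unary (M.step q a))
        (fun a => by rw [hu]; exact (M.step q a).isLt) (List.finRange k)
      rw [List.length_finRange] at this
      rw [List.length_cons]
      omega) (List.finRange n)
  rw [List.length_finRange] at h1
  simp only [FiniteDFA.encode, List.length_append, hu]
  have hn : 1 ≤ n := by omega
  obtain ⟨m, rfl⟩ : ∃ m, n = m + 1 := ⟨n - 1, by omega⟩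
  have h2 : k + 1 + (m + 1 + 1 + ((M.start : ℕ) + 1 + (m + 1) * (1 + k * (m + 1)))) ≤
      6 * ((m + 1) * (k + 1)) ^ 2 := by
    have : (M.start : ℕ) ≤ m := by omega
    ring_nf
    nlinarith [Nat.zero_le (m * k), Nat.zero_le (m ^ 2), Nat.zero_le (k ^ 2),
      Nat.zero_le (m ^ 2 * k), Nat.zero_le (m * k ^ 2), Nat.zero_le (m ^ 2 * k ^ 2)]
  exact le_trans (by gcongr) h2

open Classical in
/-- The decision problem "given `a`, does `P a` hold?" can be solved in polynomial time, where the
instance `a` is given to the machine as the word `enc a`: some fixed Turing machine (with finitely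
many stacks as tapes) halts on every such word after a number of steps that is bounded by a
polynomial in the length of the word, with the truth value of `P a` as its output. -/
def PolyTimeDecidable {ι Γ : Type} (enc : ι → List Γ) (P : ι → Prop) : Prop :=
  Nonempty (Turing.TM2ComputableInPolyTime enc Computability.encodeBool fun a => decide (P a))

end DFAClosure

/-! The language of a DFA fails to be prefix-closed exactly if deleting one last letter can leave
the language, that is, if some reachable state that is not final has a transition to a final state.
It fails to be suffix-closed exactly if deleting one first letter `a` can leave it, that is, if some
word leads from `step start a` to a final state but from `start` to a state that is not final; this
is reachability in the product of the automaton with itself. A language is factorial iff it is both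
prefix-closed and suffix-closed (`isFactorial_iff`). Reachable states and pairs are found by
saturation: by pumping down, words of length at most `n`, respectively `n * n`, suffice
(`exists_short_evalFrom_eq`).

To obtain a Turing machine, the algorithm is written in a language of registers and ternary tables
(`Cmd`), which is compiled to stack programs (`Prog`) and these to `TM2` machines. In both languages
every loop runs exactly `N` times, where `N` is the length of the input. Hence running times are
polynomial by construction, the degree being the nesting depth of the loops, and no program needs a
running time analysis of its own. The compilers are correct by `rep_run_compile` and
`reachesIn_run`. Since `k` and `n` occur in unary in the description, `N` bounds both of them, and
loops of length `N` visit all states and letters. What remains are invariants: marks are sound since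
each mark comes from a word, and complete since tables only grow. -/

namespace StackProgram

open Turing StateTransition Function

/-! ### Stack programs and their translation to machine code -/

/-- Structured programs over stacks of bits indexed by `K`. A `loop` is executed a fixed number of
times, which is a parameter of the semantics. -/
inductive Prog (K : Type) : Type
  | skip : Prog K
  | push : K → Bool → Prog K
  /-- Pop a bit and continue according to whether it was `true`, `false` or missing. -/
  | case : K → Prog K → Prog K → Prog K → Prog K
  | seq : Prog K → Prog K → Prog K
  | loop : Prog K → Prog K

namespace Prog

variable {K : Type} [DecidableEq K]

/-- The effect of a program on the stacks, where every loop is executed `N` times. -/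
def run (N : ℕ) : Prog K → (K → List Bool) → K → List Bool
  | skip, S => S
  | push k b, S => update S k (b :: S k)
  | case k p q r, S =>
    match S k with
    | true :: l => run N p (update S k l)
    | false :: l => run N q (update S k l)
    | [] => run N r S
  | seq p q, S => run N q (run N p S)
  | loop p, S => (run N p)^[N] S

/-- A bound for the running time of a program, as a polynomial in the number of loop iterations. -/
noncomputable def time : Prog K → Polynomial ℕ
  | skip => 1
  | push _ _ => 1
  | case _ p q r => 1 + p.time + q.time + r.time
  | seq p q => p.time + q.time
  | loop p => Polynomial.X * (p.time + 2) + 2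

/-- Each unit of time accounts for at most one push. The bound controls how long the final machine
needs to clear its stacks. -/
theorem length_run_le (N : ℕ) (p : Prog K) (S : K → List Bool) (k : K) :
    (p.run N S k).length ≤ (S k).length + p.time.eval N := by
  induction p generalizing S with
  | skip => simp [run]
  | push j b =>
    by_cases h : k = j
    · subst h; simp [run, time]
    · simp [run, h]
  | case j p q r ihp ihq ihr =>
    have hS : ∀ b l, S j = b :: l → (update S j l k).length ≤ (S k).length := by
      intro b l h
      by_cases hk : k = j
      · subst hk; simp [h]
      · simp [hk]
    simp only [run, time, Polynomial.eval_add]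
    rcases h : S j with - | ⟨_ | _, l⟩
    · have := ihr S
      simp only
      omega
    · have := ihq (update S j l)
      have := hS _ _ h
      simp only
      omega
    · have := ihp (update S j l)
      have := hS _ _ h
      simp only
      omega
  | seq p q ihp ihq =>
    simp only [run, time, Polynomial.eval_add]
    have := ihp S
    have := ihq (p.run N S)
    omega
  | loop p ih =>
    have key : ∀ m, ((p.run N)^[m] S k).length ≤ (S k).length + m * p.time.eval N := by
      intro m
      induction m with
      | zero => simp
      | succ m ihm =>
        rw [iterate_succ_apply', add_mul, one_mul]
        have := ih ((p.run N)^[m] S)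
        omega
    have := key N
    simp only [run, time, Polynomial.eval_add, Polynomial.eval_mul, Polynomial.eval_X,
      Polynomial.eval_ofNat, mul_add]
    omega

/-- The labels of the machine code of a program. -/
@[reducible]
def Lab : Prog K → Type
  | skip => Unit
  | push _ _ => Unit
  | case _ p q r => Unit ⊕ (Lab p ⊕ (Lab q ⊕ Lab r))
  | seq p q => Lab p ⊕ Lab q
  | loop p => Bool ⊕ Lab p

instance Lab.instFintype : (p : Prog K) → Fintype (Lab p)
  | skip => inferInstanceAs (Fintype Unit)
  | push _ _ => inferInstanceAs (Fintype Unit)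
  | case _ p q r =>
    letI := Lab.instFintype p
    letI := Lab.instFintype q
    letI := Lab.instFintype r
    inferInstanceAs (Fintype (Unit ⊕ (Lab p ⊕ (Lab q ⊕ Lab r))))
  | seq p q =>
    letI := Lab.instFintype p
    letI := Lab.instFintype q
    inferInstanceAs (Fintype (Lab p ⊕ Lab q))
  | loop p =>
    letI := Lab.instFintype p
    inferInstanceAs (Fintype (Bool ⊕ Lab p))

/-- The label at which the code of a program is entered. -/
def entry : (p : Prog K) → Lab p
  | skip => ()
  | push _ _ => ()
  | case _ _ _ _ => Sum.inl ()
  | seq p _ => Sum.inl (entry p)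
  | loop _ => Sum.inl false

variable {Λ : Type}

/-- The stack alphabets of the compiled machine: besides the stacks of the program there are two
counter stacks for each label. -/
abbrev Alphabet (K Λ : Type) : K ⊕ Λ × Bool → Type := fun _ => Bool

/-- The machine code of a program, whose labels are embedded by `e` into those of a larger machine,
and which continues at the label `x`. -/
def code : (p : Prog K) → (Lab p → Λ) → Λ → Lab p → TM2.Stmt (Alphabet K Λ) Λ (Option Bool)
  | skip, _, x, _ => .goto fun _ => x
  | push k b, _, x, _ => .push (Sum.inl k) (fun _ => b) (.goto fun _ => x)
  | case k p q r, e, x, l =>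
    match l with
    | Sum.inl _ => .pop (Sum.inl k) (fun _ s => s) (.goto fun v => match v with
        | some true => e (Sum.inr (Sum.inl (entry p)))
        | some false => e (Sum.inr (Sum.inr (Sum.inl (entry q))))
        | none => e (Sum.inr (Sum.inr (Sum.inr (entry r)))))
    | Sum.inr (Sum.inl l) => code p (fun l => e (Sum.inr (Sum.inl l))) x l
    | Sum.inr (Sum.inr (Sum.inl l)) => code q (fun l => e (Sum.inr (Sum.inr (Sum.inl l)))) x l
    | Sum.inr (Sum.inr (Sum.inr l)) => code r (fun l => e (Sum.inr (Sum.inr (Sum.inr l)))) x l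
  | seq p q, e, x, l =>
    match l with
    | Sum.inl l => code p (fun l => e (Sum.inl l)) (e (Sum.inr (entry q))) l
    | Sum.inr l => code q (fun l => e (Sum.inr l)) x l
  | loop p, e, x, l =>
    match l with
    -- Outside of the loop the counter tagged `true` holds `N` elements. They are first moved to the
    -- one tagged `false`; each iteration then moves one back. So the counter is full again on exit,
    -- and an enclosing loop can enter this one once more.
    | Sum.inl false => .pop (Sum.inr (e (Sum.inl false), true)) (fun _ s => s)
        (.branch Option.isSome
          (.push (Sum.inr (e (Sum.inl false), false)) (fun _ => true)
            (.goto fun _ => e (Sum.inl false)))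
          (.goto fun _ => e (Sum.inl true)))
    | Sum.inl true => .pop (Sum.inr (e (Sum.inl false), false)) (fun _ s => s)
        (.branch Option.isSome
          (.push (Sum.inr (e (Sum.inl false), true)) (fun _ => true)
            (.goto fun _ => e (Sum.inr (entry p))))
          (.goto fun _ => x))
    | Sum.inr l => code p (fun l => e (Sum.inr l)) (e (Sum.inl true)) l

end Prog

/-- `b` is reached from `a` in at most `t` steps of `f`. -/
def ReachesIn {α : Type} (f : α → Option α) (t : ℕ) (a b : α) : Prop :=
  Nonempty (EvalsToInTime f a (some b) t)

namespace ReachesIn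

variable {α : Type} {f : α → Option α} {s t : ℕ} {a b c : α}

theorem refl : ReachesIn f t a a :=
  ⟨⟨EvalsTo.refl f a, Nat.zero_le t⟩⟩

theorem mono (h : ReachesIn f s a b) (hst : s ≤ t) : ReachesIn f t a b :=
  let ⟨h⟩ := h
  ⟨⟨h.toEvalsTo, h.steps_le_m.trans hst⟩⟩

theorem trans (h : ReachesIn f s a b) (h' : ReachesIn f t b c) : ReachesIn f (s + t) a c :=
  let ⟨h⟩ := h
  let ⟨h'⟩ := h'
  ⟨by rw [add_comm]; exact EvalsToInTime.trans f s t a b (some c) h h'⟩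

theorem single (h : f a = some b) : ReachesIn f 1 a b :=
  ⟨⟨⟨1, h⟩, le_rfl⟩⟩

theorem head (h : f a = some b) (h' : ReachesIn f t b c) : ReachesIn f (t + 1) a c :=
  ((single h).trans h').mono (by omega)

end ReachesIn

namespace Prog

variable {K Λ : Type}

/-- The stacks of the compiled machine, for program stacks `S` and counter stacks `C`. -/
def stk (S : K → List Bool) (C : Λ × Bool → List Bool) : ∀ i, List (Alphabet K Λ i) :=
  Sum.elim S C

theorem stk_inl (S : K → List Bool) (C : Λ × Bool → List Bool) (k : K) :
    stk S C (Sum.inl k) = S k := rfl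

theorem stk_inr (S : K → List Bool) (C : Λ × Bool → List Bool) (l : Λ × Bool) :
    stk S C (Sum.inr l) = C l := rfl

variable [DecidableEq K] [DecidableEq Λ]

theorem update_stk_inl (S : K → List Bool) (C : Λ × Bool → List Bool) (k : K) (x : List Bool) :
    update (stk S C) (Sum.inl k) x = stk (update S k x) C :=
  Sum.update_elim_inl

theorem update_stk_inr (S : K → List Bool) (C : Λ × Bool → List Bool) (l : Λ × Bool)
    (x : List Bool) : update (stk S C) (Sum.inr l) x = stk S (update C l x) :=
  Sum.update_elim_inr

/-- The configuration at label `l` with program stacks `S` and counter stacks `C`. -/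
def cfg (l : Λ) (v : Option Bool) (S : K → List Bool) (C : Λ × Bool → List Bool) :
    TM2.Cfg (Alphabet K Λ) Λ (Option Bool) :=
  ⟨some l, v, stk S C⟩

variable {M : Λ → TM2.Stmt (Alphabet K Λ) Λ (Option Bool)}

/-- One iteration of the body being available, the loop runs to its end. -/
theorem reachesIn_loop_test {N : ℕ} {f : (K → List Bool) → K → List Bool} {l₀ l₁ b x : Λ} {t : ℕ}
    (h₁ : M l₁ = .pop (Sum.inr (l₀, false)) (fun _ s => s)
        (.branch Option.isSome
          (.push (Sum.inr (l₀, true)) (fun _ => true) (.goto fun _ => b))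
          (.goto fun _ => x)))
    (C : Λ × Bool → List Bool)
    (hf : ∀ v S C', (∀ l j, l ≠ l₀ → C' (l, j) = C (l, j)) →
      ∃ v', ReachesIn (TM2.step M) t (cfg b v S C') (cfg l₁ v' (f S) C'))
    (m m' : ℕ) (v : Option Bool) (S : K → List Bool) (hm : m + m' = N)
    (hC₀ : C (l₀, true) = List.replicate N true) (hC₁ : C (l₀, false) = []) :
    ∃ v', ReachesIn (TM2.step M) (m * (t + 1) + 1)
      (cfg l₁ v S (update (update C (l₀, false) (List.replicate m true))
        (l₀, true) (List.replicate m' true)))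
      (cfg x v' (f^[m] S) C) := by
  induction m generalizing v S m' with
  | zero =>
    refine ⟨none, ReachesIn.mono (ReachesIn.single ?_) (by omega)⟩
    obtain rfl : m' = N := by omega
    have : update (update C (l₀, false) (List.replicate 0 true))
        (l₀, true) (List.replicate m' true) = C := by
      rw [← hC₀, List.replicate_zero, ← hC₁, update_eq_self, update_eq_self]
    rw [this]
    have hC : update C (l₀, false) [] = C := by rw [← hC₁, update_eq_self]
    simp [cfg, h₁, hC₁, stk_inr, update_stk_inr, hC]
  | succ m ih =>
    -- The counters while the body runs: the element for the current iteration has already been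
    -- moved back.
    set C' := update (update C (l₀, false) (List.replicate m true))
        (l₀, true) (List.replicate (m' + 1) true) with hC'
    obtain ⟨v', hv'⟩ := hf (some true) S C' (by
      intro l j hl
      simp [hC', hl])
    obtain ⟨v'', hv''⟩ := ih (m' + 1) v' (f S) (by omega)
    refine ⟨v'', ReachesIn.mono (ReachesIn.head (b := cfg b (some true) S C') ?_
      (hv'.trans hv'')) (by ring_nf; omega)⟩
    simp [cfg, h₁, hC', stk_inr, update_stk_inr, List.replicate_succ]
    congr 1
    funext ⟨i, j⟩
    by_cases h : i = l₀
    · subst h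
      cases j <;> simp
    · simp [h]

theorem reachesIn_loop_refill {N : ℕ} {l₀ l₁ : Λ}
    (h₀ : M l₀ = .pop (Sum.inr (l₀, true)) (fun _ s => s)
        (.branch Option.isSome
          (.push (Sum.inr (l₀, false)) (fun _ => true) (.goto fun _ => l₀))
          (.goto fun _ => l₁)))
    (C : Λ × Bool → List Bool)
    (m m' : ℕ) (v : Option Bool) (S : K → List Bool) (hm : m + m' = N) :
    ∃ v', ReachesIn (TM2.step M) (m + 1)
      (cfg l₀ v S (update (update C (l₀, false) (List.replicate m' true))
        (l₀, true) (List.replicate m true)))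
      (cfg l₁ v' S (update (update C (l₀, false) (List.replicate N true))
        (l₀, true) (List.replicate 0 true))) := by
  induction m generalizing v m' with
  | zero =>
    obtain rfl : m' = N := by omega
    refine ⟨none, ReachesIn.single ?_⟩
    simp [cfg, h₀, stk_inr, update_stk_inr]
  | succ m ih =>
    obtain ⟨v', hv'⟩ := ih (m' + 1) (some true) (by omega)
    refine ⟨v', ReachesIn.head ?_ hv'⟩
    simp [cfg, h₀, stk_inr, update_stk_inr, List.replicate_succ]
    congr 1
    funext ⟨i, j⟩
    by_cases h : i = l₀
    · subst h
      cases j <;> simp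
    · simp [h]

/-- The machine code of a program does what the program does, in the time allotted to it. -/
theorem reachesIn_run (N : ℕ) (p : Prog K) (e : Lab p → Λ) (he : Injective e) (x : Λ)
    (hM : ∀ l, M (e l) = code p e x l) (v : Option Bool) (S : K → List Bool)
    (C : Λ × Bool → List Bool)
    (hC : ∀ l, C (e l, true) = List.replicate N true ∧ C (e l, false) = []) :
    ∃ v', ReachesIn (TM2.step M) (p.time.eval N)
      (cfg (e (entry p)) v S C) (cfg x v' (p.run N S) C) := by
  induction p generalizing x v S C with
  | skip =>
    refine ⟨v, ReachesIn.mono (ReachesIn.single ?_) (by simp [time])⟩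
    simp [cfg, entry, hM, code, run]
  | push k b =>
    refine ⟨v, ReachesIn.mono (ReachesIn.single ?_) (by simp [time])⟩
    simp [cfg, entry, hM, code, run, stk_inl, update_stk_inl]
  | case k p q r ihp ihq ihr =>
    have h : TM2.step M (cfg (e (Sum.inl ())) v S C) = some (cfg (match (S k).head? with
        | some true => e (Sum.inr (Sum.inl (entry p)))
        | some false => e (Sum.inr (Sum.inr (Sum.inl (entry q))))
        | none => e (Sum.inr (Sum.inr (Sum.inr (entry r))))) (S k).head?
          (update S k (S k).tail) C) := by
      simp [cfg, hM, code, stk_inl, update_stk_inl]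
    rcases hk : S k with - | ⟨_ | _, l⟩
    · obtain ⟨v', hv'⟩ := ihr (fun l => e (Sum.inr (Sum.inr (Sum.inr l))))
        (fun a b h => by simpa using he h) x (fun l => by rw [hM]; rfl) none S C (fun l => hC _)
      refine ⟨v', (ReachesIn.head (t := r.time.eval N) h ?_).mono ?_⟩
      · rw [hk]
        have : update S k [] = S := by rw [← hk, update_eq_self]
        simpa [run, hk, this] using hv'
      · simp only [time, Polynomial.eval_add, Polynomial.eval_one]; omega
    · obtain ⟨v', hv'⟩ := ihq (fun l => e (Sum.inr (Sum.inr (Sum.inl l))))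
        (fun a b h => by simpa using he h) x (fun l => by rw [hM]; rfl) (some false)
          (update S k l) C (fun l => hC _)
      refine ⟨v', (ReachesIn.head (t := q.time.eval N) h ?_).mono ?_⟩
      · rw [hk]
        simpa [run, hk] using hv'
      · simp only [time, Polynomial.eval_add, Polynomial.eval_one]; omega
    · obtain ⟨v', hv'⟩ := ihp (fun l => e (Sum.inr (Sum.inl l)))
        (fun a b h => by simpa using he h) x (fun l => by rw [hM]; rfl) (some true)
          (update S k l) C (fun l => hC _)
      refine ⟨v', (ReachesIn.head (t := p.time.eval N) h ?_).mono ?_⟩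
      · rw [hk]
        simpa [run, hk] using hv'
      · simp only [time, Polynomial.eval_add, Polynomial.eval_one]; omega
  | seq p q ihp ihq =>
    obtain ⟨v', hv'⟩ := ihp (fun l => e (Sum.inl l)) (fun a b h => by simpa using he h)
      (e (Sum.inr (entry q))) (fun l => by rw [hM]; rfl) v S C (fun l => hC _)
    obtain ⟨v'', hv''⟩ := ihq (fun l => e (Sum.inr l)) (fun a b h => by simpa using he h)
      x (fun l => by rw [hM]; rfl) v' (p.run N S) C (fun l => hC _)
    exact ⟨v'', by simpa [time, run, entry] using hv'.trans hv''⟩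
  | loop p ih =>
    -- The body relies only on the counters of its own labels, so the induction hypothesis applies
    -- although the counter of this loop is partly used up.
    have hne : ∀ l, e (Sum.inr l) ≠ e (Sum.inl false) := fun l h => by simpa using he h
    have hl := hC (Sum.inl false)
    obtain ⟨v', hv'⟩ := reachesIn_loop_refill (N := N) (hM (Sum.inl false)) C N 0 v S (by omega)
    obtain ⟨v'', hv''⟩ := reachesIn_loop_test (N := N) (f := p.run N) (t := p.time.eval N)
      (hM (Sum.inl true)) C (fun v S C' hC' => ih (fun l => e (Sum.inr l))
        (fun a b h => by simpa using he h) (e (Sum.inl true)) (fun l => by rw [hM]; rfl) v S C'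
        (fun l => by rw [hC' _ _ (hne l), hC' _ _ (hne l)]; exact hC _)) N 0 v' S rfl hl.1 hl.2
    have hCC : update (update C (e (Sum.inl false), false) (List.replicate 0 true))
        (e (Sum.inl false), true) (List.replicate N true) = C := by
      rw [← hl.1, List.replicate_zero, ← hl.2, update_eq_self, update_eq_self]
    rw [hCC] at hv'
    -- With `t` the time of the body, filling the counter takes `N + 1` steps and the iterations
    -- with the last, failing test take `N * (t + 1) + 1`, which gives `N * (t + 2) + 2`.
    refine ⟨v'', ReachesIn.mono (hv'.trans hv'') ?_⟩
    simp [time]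
    ring_nf
    omega

end Prog

end StackProgram

/-! ### The complete machine: loading the input, returning the answer, clearing the stacks -/

namespace StackProgram

open Turing StateTransition Function

namespace Prog

variable {K : Type} [DecidableEq K] [Fintype K]

/-- The labels of the complete machine for a program: loading the input, reading the answer,
clearing the stacks while remembering the answer, and the labels of the program itself. -/
abbrev MachineLab (p : Prog K) : Type := Bool ⊕ (Bool ⊕ Lab p)

noncomputable instance (p : Prog K) : DecidableEq (MachineLab p) := Classical.decEq _

/-- The stack for the input and the output of the complete machine. -/
abbrev io (p : Prog K) : K ⊕ MachineLab p × Bool := Sum.inr (Sum.inl false, false)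

variable {I Λ : Type} [DecidableEq I]

/-- Push `true` on all the stacks in a list, then continue. -/
def pushAll (L : List I) (q : TM2.Stmt (fun _ : I => Bool) Λ (Option Bool)) :
    TM2.Stmt (fun _ : I => Bool) Λ (Option Bool) :=
  L.foldr (fun i q => .push i (fun _ => true) q) q

/-- Pop all the stacks in a list, then continue. The internal state records if they were empty. -/
def popAll (L : List I) (q : TM2.Stmt (fun _ : I => Bool) Λ (Option Bool)) :
    TM2.Stmt (fun _ : I => Bool) Λ (Option Bool) :=
  L.foldr (fun i q => .pop i (fun v s => v.or s) q) q

theorem stepAux_pushAll (L : List I) (hL : L.Nodup)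
    (q : TM2.Stmt (fun _ : I => Bool) Λ (Option Bool)) (v : Option Bool) (T : I → List Bool) :
    TM2.stepAux (pushAll L q) v T =
      TM2.stepAux q v (fun i => if i ∈ L then true :: T i else T i) := by
  induction L generalizing T with
  | nil => simp [pushAll]
  | cons j L ih =>
    obtain ⟨hj, hL⟩ := List.nodup_cons.1 hL
    have := ih hL (update T j (true :: T j))
    simp only [pushAll, List.foldr_cons, TM2.stepAux] at this ⊢
    rw [this]
    congr 1
    funext i
    by_cases h : i = j
    · subst h; simp [hj]
    · simp [h]

/-- All the pops form one statement and thus a single machine step. Starting from `none`, the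
internal state remains `none` exactly if every stack was found empty. -/
theorem stepAux_popAll (L : List I) (hL : L.Nodup)
    (q : TM2.Stmt (fun _ : I => Bool) Λ (Option Bool)) (v : Option Bool) (T : I → List Bool) :
    ∃ v', (v' = none ↔ v = none ∧ ∀ i ∈ L, T i = []) ∧ TM2.stepAux (popAll L q) v T =
      TM2.stepAux q v' (fun i => if i ∈ L then (T i).tail else T i) := by
  induction L generalizing v T with
  | nil => exact ⟨v, by simp [popAll]⟩
  | cons j L ih =>
    obtain ⟨hj, hL⟩ := List.nodup_cons.1 hL
    obtain ⟨v', hv', h⟩ := ih hL (v.or (T j).head?) (update T j (T j).tail)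
    refine ⟨v', ?_, ?_⟩
    · rw [hv']
      have : ∀ i ∈ L, update T j (T j).tail i = T i := fun i hi =>
        update_of_ne (by rintro rfl; exact hj hi) _ _
      simp +contextual [this, and_assoc]
    · simp only [popAll, List.foldr_cons, TM2.stepAux] at h ⊢
      rw [h]
      congr 1
      funext i
      by_cases h : i = j
      · subst h; simp [hj]
      · simp [h]

/-- The program of the complete machine. -/
noncomputable def machineCode (p : Prog K) (ki ko : K) :
    MachineLab p → TM2.Stmt (Alphabet K (MachineLab p)) (MachineLab p) (Option Bool)
  -- For every input bit, one element is pushed on the `true` counters of all labels of the program.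
  -- This is how the number of loop iterations becomes the length of the input.
  | Sum.inl false => .pop p.io (fun _ s => s) (.branch Option.isSome
      (.push (Sum.inl ki) (fun v => v.getD false)
        (pushAll ((Finset.univ : Finset (Lab p)).toList.map
          fun l => Sum.inr (Sum.inr (Sum.inr l), true))
          (.goto fun _ => Sum.inl false)))
      (.goto fun _ => Sum.inr (Sum.inr p.entry)))
  | Sum.inl true => .pop (Sum.inl ko) (fun _ s => s)
      (.goto fun v => Sum.inr (Sum.inl (v.getD false)))
  | Sum.inr (Sum.inl b) => .load (fun _ => none) (popAll Finset.univ.toList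
      (.branch Option.isSome (.goto fun _ => Sum.inr (Sum.inl b))
        (.push p.io (fun _ => b) (.load (fun _ => none) .halt))))
  | Sum.inr (Sum.inr l) => code p (fun l => Sum.inr (Sum.inr l)) (Sum.inl true) l

/-- The complete machine, which loads its input in reverse on the stack `ki`, runs the program, and
returns the top of the stack `ko`. -/
noncomputable def machine (p : Prog K) (ki ko : K) : FinTM2 where
  K := K ⊕ MachineLab p × Bool
  k₀ := p.io
  k₁ := p.io
  Γ := Alphabet K (MachineLab p)
  Λ := MachineLab p
  main := Sum.inl false
  σ := Option Bool
  initialState := none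
  Γk₀Fin := inferInstanceAs (Fintype Bool)
  m := p.machineCode ki ko

/-- The counter stacks after `m` input bits have been read and `l` remains. -/
def loadStk (p : Prog K) (m : ℕ) (l : List Bool) : MachineLab p × Bool → List Bool
  | (Sum.inr (Sum.inr _), true) => List.replicate m true
  | (Sum.inl false, false) => l
  | _ => []

theorem reachesIn_load (p : Prog K) (ki ko : K) (l l' : List Bool) (v : Option Bool) :
    ∃ v', ReachesIn (TM2.step (p.machineCode ki ko)) (l.length + 1)
      (cfg (Sum.inl false) v (update (fun _ => []) ki l') (p.loadStk l'.length l))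
      (cfg (Sum.inr (Sum.inr p.entry)) v' (update (fun _ => []) ki (l.reverse ++ l'))
        (p.loadStk (l.length + l'.length) [])) := by
  induction l generalizing l' v with
  | nil =>
    refine ⟨none, ReachesIn.single ?_⟩
    have : update (p.loadStk l'.length []) (Sum.inl false, false) [] = p.loadStk l'.length [] :=
      update_eq_self _ _
    simp only [cfg, TM2.step, machineCode, TM2.stepAux, stk_inr, update_stk_inr]
    simp [loadStk, this]
  | cons b l ih =>
    obtain ⟨v', hv'⟩ := ih (b :: l') (some b)
    refine ⟨v', ReachesIn.head ?_ (by
      simpa [List.append_assoc, add_assoc, add_comm 1] using hv')⟩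
    simp only [cfg, TM2.step, machineCode, TM2.stepAux, stk_inr, update_stk_inr]
    rw [stepAux_pushAll _ (by
      refine List.Nodup.map ?_ (Finset.nodup_toList _)
      intro a b h; simpa using h)]
    simp only [loadStk, List.head?_cons, Option.isSome_some, cond_true, Option.some.injEq,
      TM2.stepAux, stk_inl, update_stk_inl, Option.getD_some, TM2.Cfg.mk.injEq, true_and]
    funext i
    rcases i with i | ⟨_ | i | i, _ | _⟩ <;>
      simp [stk, loadStk, update_apply, List.replicate_succ]
    rename_i j
    cases j <;> simp

/-- Every round is one step and shortens all nonempty stacks at once, so the maximal length matters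
and not the sum. One more round notices that all are empty. The answer `b` survives in the label. -/
theorem reachesIn_clear (p : Prog K) (ki ko : K) (b : Bool) (m : ℕ) (v : Option Bool)
    (T : K ⊕ MachineLab p × Bool → List Bool) (hT : ∀ i, (T i).length ≤ m) :
    ReachesIn (TM2.step (p.machineCode ki ko)) (m + 1)
      ⟨some (Sum.inr (Sum.inl b)), v, T⟩ ⟨none, none, update (fun _ => []) p.io [b]⟩ := by
  induction m generalizing v T with
  | zero =>
    refine ReachesIn.single ?_
    obtain ⟨v', hv', h⟩ := stepAux_popAll (Λ := MachineLab p)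
      (Finset.univ.toList) (Finset.nodup_toList _)
      (.branch Option.isSome (.goto fun _ => Sum.inr (Sum.inl b))
        (.push p.io (fun _ => b) (.load (fun _ => none) .halt))) none T
    have hT' : T = fun _ => [] := funext fun i => by simpa using hT i
    obtain rfl : v' = none := by simp [hv', hT']
    simp only [TM2.step, machineCode, TM2.stepAux]
    rw [h, hT']
    simp
  | succ m ih =>
    obtain ⟨v', hv', h⟩ := stepAux_popAll (Λ := MachineLab p)
      (Finset.univ.toList) (Finset.nodup_toList _)
      (.branch Option.isSome (.goto fun _ => Sum.inr (Sum.inl b))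
        (.push p.io (fun _ => b) (.load (fun _ => none) .halt))) none T
    cases v' with
    | none =>
      refine ReachesIn.mono (ReachesIn.single ?_) (Nat.le_add_left 1 _)
      have hT' : T = fun _ => [] := funext fun i => (hv'.1 rfl).2 i (by simp)
      simp only [TM2.step, machineCode, TM2.stepAux]
      rw [h, hT']
      simp
    | some c =>
      refine ReachesIn.head ?_ (ih (some c) (fun i => (T i).tail) (fun i => by
        have := hT i
        simp only [List.length_tail]
        omega))
      simp only [TM2.step, machineCode, TM2.stepAux]
      rw [h]
      simp

theorem initList_machine (p : Prog K) (ki ko : K) (l : List Bool) :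
    initList (p.machine ki ko) l =
      cfg (Sum.inl false) none (update (fun _ => []) ki []) (p.loadStk 0 l) := by
  refine congrArg (TM2.Cfg.mk (some (Sum.inl false)) none) ?_
  funext i
  by_cases hi : i = p.io
  · subst hi
    exact dif_pos rfl
  · refine (dif_neg hi).trans ?_
    rcases i with i | ⟨(_ | _) | _ | _, _ | _⟩
    · exact (congrFun (update_eq_self (f := fun _ : K => ([] : List Bool)) ki) i).symm
    · exact absurd rfl hi
    all_goals rfl

theorem haltList_machine (p : Prog K) (ki ko : K) (l : List Bool) :
    haltList (p.machine ki ko) l = ⟨none, none, update (fun _ => []) p.io l⟩ := by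
  refine congrArg (TM2.Cfg.mk none none) ?_
  funext i
  by_cases hi : i = p.io
  · subst hi
    exact (dif_pos rfl).trans (update_self (β := fun _ => List Bool) _ _ _).symm
  · exact (dif_neg hi).trans
      (update_of_ne (β := fun _ => List Bool) hi l (fun _ => [])).symm

/-- A property that is decided by a stack program is decidable in polynomial time. -/
theorem polyTimeDecidable {ι : Type} {enc : ι → List Bool} {P : ι → Prop} (p : Prog K) (ki ko : K)
    (h : ∀ a, P a ↔ (p.run (enc a).length (update (fun _ => []) ki (enc a).reverse) ko).head? =
      some true) : DFAClosure.PolyTimeDecidable enc P := by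
  classical
  refine ⟨{ tm := p.machine ki ko
            inputAlphabet := Equiv.refl Bool
            outputAlphabet := Equiv.refl Bool
            -- Loading takes `N + 1` steps, the program at most `p.time`, reading the answer `1`,
            -- and clearing stacks of length at most `N + p.time` takes `N + p.time + 1`.
            time := 2 * (Polynomial.X + p.time) + 3
            outputsFun := fun a => Classical.choice ?_ }⟩
  set w := enc a
  set N := w.length with hN
  set S := p.run N (update (fun _ => []) ki w.reverse) with hS
  obtain ⟨v₁, h₁⟩ := p.reachesIn_load ki ko w [] none
  obtain ⟨v₂, h₂⟩ := reachesIn_run (M := p.machineCode ki ko) N p (fun l => Sum.inr (Sum.inr l))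
    (fun a b h => by simpa using h) (Sum.inl true) (fun l => rfl) v₁
    (update (fun _ => []) ki w.reverse) (p.loadStk N []) (fun l => ⟨rfl, rfl⟩)
  have h₃ : ReachesIn (TM2.step (p.machineCode ki ko)) 1
      (cfg (Sum.inl true) v₂ S (p.loadStk N []))
      (cfg (Sum.inr (Sum.inl ((S ko).head?.getD false))) (S ko).head? (update S ko (S ko).tail)
        (p.loadStk N [])) := by
    refine ReachesIn.single ?_
    simp [cfg, machineCode, stk_inl, update_stk_inl]
  have h₄ := p.reachesIn_clear ki ko ((S ko).head?.getD false) (N + p.time.eval N) (S ko).head?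
    (stk (update S ko (S ko).tail) (p.loadStk N [])) (by
      rintro (k | ⟨_ | _ | _, _ | _⟩)
      · have hk : (S k).length ≤ N + p.time.eval N := by
          refine (p.length_run_le N _ k).trans ?_
          gcongr
          by_cases hk : k = ki
          · subst hk; simp [hN]
          · simp [hk]
        by_cases hk' : k = ko
        · subst hk'
          simp only [stk_inl, update_self, List.length_tail]
          omega
        · simpa [stk_inl, hk'] using hk
      all_goals simp [stk_inr, loadStk]
      all_goals split <;> simp)
  have hb : (S ko).head?.getD false = decide (P a) := by
    rw [Bool.eq_iff_iff, decide_eq_true_iff, h]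
    rcases (S ko).head? with - | _ | _ <;> simp
  rw [hb] at h₃ h₄
  rw [List.append_nil, List.length_nil, add_zero] at h₁
  obtain ⟨H⟩ := ((h₁.trans h₂).trans h₃).trans h₄
  have hinit := (congrArg (initList (p.machine ki ko)) (List.map_id w)).trans
    (p.initList_machine ki ko w)
  have hhalt := p.haltList_machine ki ko [decide (P a)]
  refine ⟨⟨⟨H.steps, ?_⟩, H.steps_le_m.trans ?_⟩⟩
  · exact (congrArg (fun c => (flip bind (TM2.step (p.machineCode ki ko)))^[H.steps] (some c))
      hinit).trans (H.evals_in_steps.trans (congrArg some hhalt.symm))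
  · simp only [Polynomial.eval_add, Polynomial.eval_mul, Polynomial.eval_X, Polynomial.eval_ofNat]
    omega

end Prog

end StackProgram

/-! ### Subroutines on stacks: counting and random access -/

namespace StackProgram

open Turing StateTransition Function

/-- A loop cannot be left early; this allows one whose work is done after `n` rounds to idle for the
others. -/
theorem iterate_eq_of_fixed {α : Type} {f : α → α} {a b : α} {n N : ℕ} (h : f^[n] a = b)
    (hb : f b = b) (hn : n ≤ N) : f^[N] a = b := by
  obtain ⟨m, rfl⟩ := Nat.exists_eq_add_of_le hn
  rw [add_comm, iterate_add_apply, h, iterate_fixed hb]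

namespace Prog

variable {K : Type} [DecidableEq K] {N : ℕ}

/-- The program `p` neither uses nor changes the stack `k`. -/
def Indep (N : ℕ) (p : Prog K) (k : K) : Prop :=
  ∀ S l, p.run N (update S k l) = update (p.run N S) k l

theorem Indep.iterate {p : Prog K} {k : K} (h : Indep N p k) (n : ℕ) (S : K → List Bool)
    (l : List Bool) : (p.run N)^[n] (update S k l) = update ((p.run N)^[n] S) k l := by
  induction n generalizing S with
  | zero => rfl
  | succ n ih => rw [iterate_succ_apply, iterate_succ_apply, h, ih]

theorem Indep.iterate_apply {p : Prog K} {k : K} (h : Indep N p k) (n : ℕ) (S : K → List Bool) :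
    (p.run N)^[n] S k = S k := by
  have := congrFun (h.iterate n S (S k)) k
  rwa [update_eq_self, update_self] at this

/-- Repeat a program once more than a loop does. -/
def rep (p : Prog K) : Prog K := seq (loop p) p

theorem run_rep (p : Prog K) (S : K → List Bool) : p.rep.run N S = (p.run N)^[N + 1] S := by
  rw [iterate_succ_apply']
  rfl

theorem Indep.rep {p : Prog K} {k : K} (h : Indep N p k) : Indep N p.rep k := fun S l => by
  rw [run_rep, run_rep, h.iterate]

/-- Move the elements of `a` to `b`, which are assumed to be `true`. -/
def transfer (a b : K) : Prog K := loop (case a (push b true) skip skip)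

/-- The number `j` of rounds may be less than `n`. This is needed for `inc`, where a stack can hold
`N + 1` elements and the loop leaves one behind. -/
theorem iterate_transfer {a b : K} (hab : a ≠ b) (S : K → List Bool) {n m j : ℕ}
    (ha : S a = List.replicate n true) (hb : S b = List.replicate m true) (hj : j ≤ n) :
    ((case a (push b true) skip skip).run N)^[j] S =
      update (update S a (List.replicate (n - j) true)) b (List.replicate (m + j) true) := by
  induction j with
  | zero => simp [← ha, ← hb]
  | succ j ih =>
    rw [iterate_succ_apply', ih (by omega)]
    obtain ⟨d, rfl⟩ : ∃ d, n = j + 1 + d := ⟨n - (j + 1), by omega⟩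
    have h1 : j + 1 + d - j = d + 1 := by omega
    have h2 : j + 1 + d - (j + 1) = d := by omega
    rw [h1, h2]
    funext k
    by_cases hk : k = a
    · subst hk
      simp [run, hab, List.replicate_succ]
    · by_cases hk' : k = b
      · subst hk'
        simp [run, hab, hk, List.replicate_succ, ← add_assoc]
      · simp [run, hab, List.replicate_succ, hk, hk']

theorem run_transfer {a b : K} (hab : a ≠ b) (S : K → List Bool) {n m : ℕ}
    (ha : S a = List.replicate n true) (hb : S b = List.replicate m true) (hn : n ≤ N) :
    (transfer a b).run N S = update (update S a []) b (List.replicate (m + n) true) := by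
  refine iterate_eq_of_fixed (n := n) ?_ ?_ hn
  · simpa using iterate_transfer hab S ha hb le_rfl
  · simp [run, hab]

/-- Run `p` once for each element of `r`, using `t` as scratch space. -/
def seek (r t : K) (p : Prog K) : Prog K :=
  seq (loop (case r (seq (push t true) p) skip skip)) (transfer t r)

/-- Each element popped from `r` is kept on `t` and put back in the end. Since `p` is independent of
both stacks, this bookkeeping commutes with it. -/
theorem run_seek {r t : K} (hrt : r ≠ t) {p : Prog K} (hr : Indep N p r) (ht : Indep N p t)
    (S : K → List Bool) {n : ℕ} (hS : S r = List.replicate n true) (hS' : S t = [])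
    (hn : n ≤ N) : (seek r t p).run N S = (p.run N)^[n] S := by
  have key : ∀ j ≤ n, ((case r (seq (push t true) p) skip skip).run N)^[j] S =
      update (update ((p.run N)^[j] S) r (List.replicate (n - j) true)) t
        (List.replicate j true) := by
    intro j hj
    induction j with
    | zero => simp [← hS, ← hS']
    | succ j ih =>
      rw [iterate_succ_apply', ih (by omega)]
      obtain ⟨d, rfl⟩ : ∃ d, n = j + 1 + d := ⟨n - (j + 1), by omega⟩
      have h1 : j + 1 + d - j = d + 1 := by omega
      have h2 : j + 1 + d - (j + 1) = d := by omega
      rw [h1, h2, iterate_succ_apply', ← hr, ← ht]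
      simp only [run, update_of_ne hrt, update_self, List.replicate_succ]
      congr 1
      funext k
      by_cases hk : k = r
      · subst hk
        simp [hrt]
      · by_cases hk' : k = t
        · subst hk'
          simp [hrt.symm]
        · simp [hk, hk']
  have h1 : (loop (case r (seq (push t true) p) skip skip)).run N S =
      update (update ((p.run N)^[n] S) r []) t (List.replicate n true) := by
    refine iterate_eq_of_fixed (n := n) ?_ ?_ hn
    · simpa using key n le_rfl
    · simp [run, hrt]
  change (transfer t r).run N ((loop _).run N S) = _
  rw [h1, run_transfer (n := n) (m := 0) hrt.symm _ (by simp) (by simp [hrt]) hn]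
  funext k
  by_cases hk : k = r
  · subst hk
    simp [hr.iterate_apply, hS]
  · by_cases hk' : k = t
    · subst hk'
      simp [hk, ht.iterate_apply, hS']
    · simp [hk, hk']

/-- Run `p` as often as the number with digits `x`, `y`, `z` in base `N + 1`. -/
def access (x y z t : K) (p : Prog K) : Prog K :=
  seq (seek x t p.rep.rep) (seq (seek y t p.rep) (seek z t p))

/-- The place of the entry `x`, `y`, `z` in a table. -/
def index (N x y z : ℕ) : ℕ := (x * (N + 1) + y) * (N + 1) + z

/-- Digits in base `N + 1` are unique; the leading one needs no bound. -/
theorem index_inj {N x y z x' y' z' : ℕ} (hy : y ≤ N) (hz : z ≤ N) (hy' : y' ≤ N) (hz' : z' ≤ N) :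
    index N x y z = index N x' y' z' ↔ x = x' ∧ y = y' ∧ z = z' := by
  refine ⟨fun h => ?_, by rintro ⟨rfl, rfl, rfl⟩; rfl⟩
  have aux : ∀ a b c d : ℕ, b ≤ N → d ≤ N → a * (N + 1) + b = c * (N + 1) + d → a = c ∧ b = d := by
    intro a b c d hb hd h
    have h1 := congrArg (· / (N + 1)) h
    have h2 := congrArg (· % (N + 1)) h
    simp only [mul_comm _ (N + 1)] at h1 h2
    rw [Nat.mul_add_div (by omega), Nat.mul_add_div (by omega), Nat.div_eq_of_lt (by omega),
      Nat.div_eq_of_lt (by omega)] at h1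
    rw [Nat.mul_add_mod, Nat.mul_add_mod, Nat.mod_eq_of_lt (by omega),
      Nat.mod_eq_of_lt (by omega)] at h2
    exact ⟨by omega, h2⟩
  obtain ⟨h1, h2⟩ := aux _ _ _ _ hz hz' h
  obtain ⟨h3, h4⟩ := aux _ _ _ _ hy hy' h1
  exact ⟨h3, h4, h2⟩

/-- `p.rep` runs `p` as often as `N + 1` says and `p.rep.rep` as often as `(N + 1) * (N + 1)`, which
are the place values of the digits `y` and `x`. -/
theorem run_access {x y z t : K} (hx : x ≠ t) (hy : y ≠ t) (hz : z ≠ t) {p : Prog K}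
    (hpx : Indep N p x) (hpy : Indep N p y) (hpz : Indep N p z) (hpt : Indep N p t)
    (S : K → List Bool) {i j k : ℕ} (hi : S x = List.replicate i true)
    (hj : S y = List.replicate j true) (hk : S z = List.replicate k true) (hS : S t = [])
    (hiN : i ≤ N) (hjN : j ≤ N) (hkN : k ≤ N) :
    (access x y z t p).run N S = (p.run N)^[index N i j k] S := by
  have hrep : p.rep.run N = (p.run N)^[N + 1] := funext fun S => run_rep p S
  have hrep' : p.rep.rep.run N = (p.run N)^[(N + 1) * (N + 1)] := by
    rw [iterate_mul, ← hrep]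
    exact funext fun S => run_rep _ S
  have h1 : (seek x t p.rep.rep).run N S = (p.run N)^[(N + 1) * (N + 1) * i] S := by
    rw [run_seek hx hpx.rep.rep hpt.rep.rep S hi hS hiN, hrep', ← iterate_mul]
  have h2 : ∀ S, S y = List.replicate j true → S t = [] →
      (seek y t p.rep).run N S = (p.run N)^[(N + 1) * j] S := fun S h h' => by
    rw [run_seek hy hpy.rep hpt.rep S h h' hjN, hrep, ← iterate_mul]
  change (seek z t p).run N ((seek y t p.rep).run N ((seek x t p.rep.rep).run N S)) = _
  rw [h1, h2 _ (by rw [hpy.iterate_apply, hj]) (by rw [hpt.iterate_apply, hS]),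
    run_seek hz hpz hpt _ (by rw [hpz.iterate_apply, hpz.iterate_apply, hk])
      (by rw [hpt.iterate_apply, hpt.iterate_apply, hS]) hkN, ← iterate_add_apply,
    ← iterate_add_apply]
  refine congrArg (fun n => (p.run N)^[n] S) ?_
  simp only [index]
  ring

/-- Move one element from `a` to `b`, where the empty stack is taken to consist of `false`. -/
def move (a b : K) : Prog K := case a (push b true) (push b false) (push b false)

theorem run_move {a b : K} (hab : a ≠ b) (S : K → List Bool) :
    (move a b).run N S = update (update S a (S a).tail) b ((S a).headD false :: S b) := by
  rcases h : S a with - | ⟨_ | _, l⟩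
  · have : update S a [] = S := by rw [← h, update_eq_self]
    simp [move, run, h, this]
  · simp [move, run, h, hab.symm]
  · simp [move, run, h, hab.symm]

theorem indep_move {a b k : K} (hab : a ≠ b) (hka : k ≠ a) (hkb : k ≠ b) :
    Indep N (move a b) k := by
  intro S l
  rw [run_move hab, run_move hab]
  funext j
  by_cases hj : j = a
  · subst hj; simp [hka.symm, hab]
  · by_cases hj' : j = b
    · subst hj'; simp [hkb.symm, hka.symm]
    · simp [hj, hj', update_apply]

/-- The first `i` elements of a list that is continued by `false`. -/
def paddedTake (i : ℕ) (l : List Bool) : List Bool := (List.range i).map fun j => l.getD j false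

theorem length_paddedTake (i : ℕ) (l : List Bool) : (paddedTake i l).length = i := by
  simp [paddedTake]

/-- Moving past the end of `a` creates elements `false`. Tables can therefore start as empty stacks,
and going to a place and back changes a table at most by padding. -/
theorem iterate_move {a b : K} (hab : a ≠ b) (i : ℕ) (S : K → List Bool) :
    ((move a b).run N)^[i] S =
      update (update S a ((S a).drop i)) b ((paddedTake i (S a)).reverse ++ S b) := by
  induction i with
  | zero => simp [paddedTake]
  | succ i ih =>
    rw [iterate_succ_apply', ih, run_move hab]
    funext k
    by_cases hk : k = a
    · subst hk
      simp [hab]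
    · by_cases hk' : k = b
      · subst hk'
        simp [hab, paddedTake, List.range_succ, List.headD_eq_head?_getD]
      · simp [hk, hk']

theorem paddedTake_append {l l' : List Bool} : paddedTake l.length (l ++ l') = l := by
  refine List.ext_getElem (length_paddedTake _ _) fun n h1 h2 => ?_
  simp [paddedTake, List.getElem?_append_left h2, List.getElem?_eq_getElem h2]

theorem getD_paddedTake_append (i j : ℕ) (l l' : List Bool) :
    (paddedTake i l ++ l').getD j false = if j < i then l.getD j false else l'.getD (j - i) false := by
  split_ifs with h
  · rw [List.getD_append _ _ _ _ (by rwa [length_paddedTake])]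
    simp [paddedTake, h]
  · rw [List.getD_append_right _ _ _ _ (by rw [length_paddedTake]; omega), length_paddedTake]

end Prog

end StackProgram

/-! ### Register programs with tables and their translation to stack programs -/

namespace StackProgram

open Turing StateTransition Function

/-- Programs over registers `R`, which hold numbers that are at most the length `N` of the input,
and ternary tables `T`. -/
inductive Cmd (R T : Type) : Type
  | skip : Cmd R T
  | zero : R → Cmd R T
  | inc : R → Cmd R T
  | ifEq : R → R → Cmd R T → Cmd R T → Cmd R T
  | ifTab : T → R → R → R → Cmd R T → Cmd R T → Cmd R T
  | set : T → R → R → R → Cmd R T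
  | seq : Cmd R T → Cmd R T → Cmd R T
  | loop : Cmd R T → Cmd R T

/-- The states on which register programs operate. -/
structure State (R T : Type) where
  reg : R → ℕ
  tab : T → ℕ → ℕ → ℕ → Prop

namespace State

variable {R T : Type} [DecidableEq R]

/-- Change the value of a register. -/
def setReg (s : State R T) (r : R) (n : ℕ) : State R T := ⟨update s.reg r n, s.tab⟩

/-- Insert a triple into a table. -/
def setTab (s : State R T) (t : T) (x y z : ℕ) : State R T :=
  ⟨s.reg, fun t' x' y' z' => s.tab t' x' y' z' ∨ t' = t ∧ x' = x ∧ y' = y ∧ z' = z⟩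

end State

namespace Cmd

variable {R T : Type} [DecidableEq R]

open Classical in
/-- The effect of a register program on inputs of length `N`. -/
noncomputable def eval (N : ℕ) : Cmd R T → State R T → State R T
  | skip, s => s
  | zero r, s => s.setReg r 0
  -- Saturation keeps every register a valid digit in base `N + 1`.
  | inc r, s => s.setReg r (min (s.reg r + 1) N)
  | ifEq r r' p q, s => if s.reg r = s.reg r' then eval N p s else eval N q s
  | ifTab t x y z p q, s =>
    if s.tab t (s.reg x) (s.reg y) (s.reg z) then eval N p s else eval N q s
  | set t x y z, s => s.setTab t (s.reg x) (s.reg y) (s.reg z)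
  | seq p q, s => eval N q (eval N p s)
  | loop p, s => (eval N p)^[N] s

/-- The stacks for registers and tables, and two scratch stacks. -/
abbrev Stack (R T : Type) : Type := R ⊕ T ⊕ Bool

/-- The stack that holds the register `r`. -/
abbrev rs (r : R) : Stack R T := Sum.inl r

/-- The stack that holds the table `t`. -/
abbrev ts (t : T) : Stack R T := Sum.inr (Sum.inl t)

/-- The scratch stack for registers. -/
abbrev rtmp : Stack R T := Sum.inr (Sum.inr false)

/-- The scratch stack for tables. -/
abbrev ttmp : Stack R T := Sum.inr (Sum.inr true)

/-- The stacks `S` hold the state `s`. -/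
structure Rep (N : ℕ) (S : Stack R T → List Bool) (s : State R T) : Prop where
  reg : ∀ r, S (rs r) = List.replicate (s.reg r) true
  reg_le : ∀ r, s.reg r ≤ N
  tab : ∀ t x y z, x ≤ N → y ≤ N → z ≤ N →
    ((S (ts t)).getD (Prog.index N x y z) false = true ↔ s.tab t x y z)
  rtmp : S rtmp = []
  ttmp : S ttmp = []

/-- Go to the place of an entry in a table. -/
def goto (t : T) (x y z : R) : Prog (Stack R T) :=
  .access (rs x) (rs y) (rs z) rtmp (.move (ts t) ttmp)

/-- Return from the place of an entry in a table. -/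
def back (t : T) (x y z : R) : Prog (Stack R T) :=
  .access (rs x) (rs y) (rs z) rtmp (.move ttmp (ts t))

/-- Put back as many elements on `r` and `r'` as there are on the scratch stack. -/
def restore (r r' : R) : Prog (Stack R T) :=
  .loop (.case rtmp (.seq (.push (rs r) true) (.push (rs r') true)) .skip .skip)

/-- Stack programs for register programs. -/
def compile : Cmd R T → Prog (Stack R T)
  | skip => .skip
  | zero r => .loop (.case (rs r) .skip .skip .skip)
  -- A transfer moves at most `N` elements, so an element beyond `N` stays on the register, where
  -- the `case` discards it.
  | inc r => .seq (.push (rs r) true) (.seq (.transfer (rs r) rtmp)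
      (.seq (.case (rs r) .skip .skip .skip) (.transfer rtmp (rs r))))
  | ifEq r r' p q =>
    -- Cancelling elements in pairs requires two different stacks. The element popped from `r` is
    -- put back if `r'` turns out to be empty, so the numbers differ iff one of the stacks is
    -- nonempty after the loop.
    if r = r' then compile p else
      .seq (.loop (.case (rs r) (.case (rs r') (.push rtmp true) .skip (.push (rs r) true))
        .skip .skip))
      (.case (rs r) (.seq (.push (rs r) true) (.seq (restore r r') (compile q))) .skip
        (.case (rs r') (.seq (.push (rs r') true) (.seq (restore r r') (compile q))) .skip
          (.seq (restore r r') (compile p))))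
  | ifTab t x y z p q => .seq (goto t x y z) (.case (ts t)
      (.seq (.push (ts t) true) (.seq (back t x y z) (compile p)))
      (.seq (.push (ts t) false) (.seq (back t x y z) (compile q)))
      -- A place beyond the end of the stack counts as `false`, and nothing was popped that must be
      -- pushed again.
      (.seq (back t x y z) (compile q)))
  | set t x y z => .seq (goto t x y z) (.seq (.case (ts t) .skip .skip .skip)
      (.seq (.push (ts t) true) (back t x y z)))
  | seq p q => .seq (compile p) (compile q)
  | loop p => .loop (compile p)

variable [DecidableEq T] {N : ℕ}

theorem run_goto {S : Stack R T → List Bool} {s : State R T} (h : Rep N S s) (t : T) (x y z : R) :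
    (goto t x y z).run N S =
      update (update S (ts t) ((S (ts t)).drop (Prog.index N (s.reg x) (s.reg y) (s.reg z)))) ttmp
        (Prog.paddedTake (Prog.index N (s.reg x) (s.reg y) (s.reg z)) (S (ts t))).reverse := by
  rw [goto, Prog.run_access (by simp) (by simp) (by simp) (Prog.indep_move (by simp) (by simp)
    (by simp)) (Prog.indep_move (by simp) (by simp) (by simp)) (Prog.indep_move (by simp) (by simp)
    (by simp)) (Prog.indep_move (by simp) (by simp) (by simp)) S (h.reg x) (h.reg y) (h.reg z)
    h.rtmp (h.reg_le x) (h.reg_le y) (h.reg_le z), Prog.iterate_move (by simp), h.ttmp,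
    List.append_nil]

theorem run_back {S : Stack R T → List Bool} {s : State R T} (h : Rep N S s) (t : T) (x y z : R)
    {l u : List Bool} (hu : u.length = Prog.index N (s.reg x) (s.reg y) (s.reg z)) :
    (back t x y z).run N (update (update S (ts t) l) ttmp u.reverse) =
      update S (ts t) (u ++ l) := by
  have hlen : Prog.index N (s.reg x) (s.reg y) (s.reg z) = u.reverse.length := by simp [hu]
  rw [back, Prog.run_access (by simp) (by simp) (by simp) (Prog.indep_move (by simp) (by simp)
    (by simp)) (Prog.indep_move (by simp) (by simp) (by simp)) (Prog.indep_move (by simp) (by simp)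
    (by simp)) (Prog.indep_move (by simp) (by simp) (by simp)) _ (i := s.reg x) (j := s.reg y)
    (k := s.reg z) (by simp [h.reg]) (by simp [h.reg]) (by simp [h.reg])
    (by simp [h.rtmp]) (h.reg_le x) (h.reg_le y) (h.reg_le z), Prog.iterate_move (by simp), hlen]
  have := Prog.paddedTake_append (l := u.reverse) (l' := [])
  rw [List.append_nil] at this
  funext k
  by_cases hk : k = ts t
  · subst hk
    simp only [update_self, ne_eq, reduceCtorEq, not_false_eq_true, update_of_ne, Sum.inr.injEq]
    rw [this, List.reverse_reverse]
  · by_cases hk' : k = ttmp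
    · subst hk'
      simp [h.ttmp]
    · simp [hk, hk']

/-- Replacing a table by a stack with the same entries. -/
theorem Rep.update_tab {S : Stack R T → List Bool} {s : State R T} (h : Rep N S s) (t : T)
    {l : List Bool} {s' : State R T} (hreg : s'.reg = s.reg)
    (htab : ∀ t' x y z, t' ≠ t → (s'.tab t' x y z ↔ s.tab t' x y z))
    (hl : ∀ x y z, x ≤ N → y ≤ N → z ≤ N →
      (l.getD (Prog.index N x y z) false = true ↔ s'.tab t x y z)) :
    Rep N (update S (ts t) l) s' where
  reg r := by simp [h.reg, hreg]
  reg_le r := by rw [hreg]; exact h.reg_le r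
  tab t' x y z hx hy hz := by
    by_cases ht : t' = t
    · subst ht
      rw [update_self, hl x y z hx hy hz]
    · rw [update_of_ne (by simpa using ht), h.tab t' x y z hx hy hz, htab t' x y z ht]
  rtmp := by simp [h.rtmp]
  ttmp := by simp [h.ttmp]

theorem Rep.setReg {S : Stack R T → List Bool} {s : State R T} (h : Rep N S s) (r : R) {n : ℕ}
    (hn : n ≤ N) : Rep N (update S (rs r) (List.replicate n true)) (s.setReg r n) where
  reg r' := by
    by_cases hr : r' = r
    · subst hr; simp [State.setReg]
    · simp [State.setReg, hr, h.reg]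
  reg_le r' := by
    by_cases hr : r' = r
    · subst hr; simpa [State.setReg] using hn
    · simpa [State.setReg, hr] using h.reg_le r'
  tab t x y z hx hy hz := by simpa [State.setReg] using h.tab t x y z hx hy hz
  rtmp := by simp [h.rtmp]
  ttmp := by simp [h.ttmp]

theorem run_compile_zero {S : Stack R T → List Bool} {s : State R T} (h : Rep N S s) (r : R) :
    (compile (zero r)).run N S = update S (rs r) [] := by
  have key : ∀ j, ((Prog.case (rs r : Stack R T) .skip .skip .skip).run N)^[j] S =
      update S (rs r) (List.replicate (s.reg r - j) true) := by
    intro j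
    induction j with
    | zero => simp [← h.reg]
    | succ j ih =>
      rw [iterate_succ_apply', ih]
      rcases hd : s.reg r - j with - | d
      · have : s.reg r - (j + 1) = 0 := by omega
        simp [Prog.run, this]
      · have : s.reg r - (j + 1) = d := by omega
        simp [Prog.run, this, List.replicate_succ]
  have hle := h.reg_le r
  have : s.reg r - N = 0 := by omega
  change ((Prog.case (rs r : Stack R T) .skip .skip .skip).run N)^[N] S = _
  rw [key, this, List.replicate_zero]

theorem run_compile_inc {S : Stack R T → List Bool} {s : State R T} (h : Rep N S s) (r : R) :
    (compile (inc r)).run N S =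
      update S (rs r) (List.replicate (min (s.reg r + 1) N) true) := by
  have hle := h.reg_le r
  have h0 : (rs r : Stack R T) ≠ rtmp := by simp
  set S₁ := update S (rs r) (List.replicate (s.reg r + 1) true) with hS₁
  have h1 : (Prog.push (rs r : Stack R T) true).run N S = S₁ := by
    simp [Prog.run, hS₁, h.reg, List.replicate_succ]
  have h2 : (Prog.transfer (rs r : Stack R T) rtmp).run N S₁ =
      update (update S (rs r) (List.replicate (s.reg r + 1 - N) true)) rtmp
        (List.replicate (min (s.reg r + 1) N) true) := by
    rcases hle.lt_or_eq with hlt | heq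
    · have e1 : s.reg r + 1 - N = 0 := by omega
      rw [Prog.run_transfer (n := s.reg r + 1) (m := 0) h0 _ (by simp [hS₁])
        (by simp [hS₁, h.rtmp]) (by omega), e1, min_eq_left (by omega)]
      simp [hS₁]
    -- The register already holds `N`: there are `N + 1` elements and the loop moves only `N` of
    -- them.
    · have e1 : s.reg r + 1 - N = 1 := by omega
      refine (Prog.iterate_transfer (n := s.reg r + 1) (m := 0) h0 _ (by simp [hS₁])
        (by simp [hS₁, h.rtmp]) (by omega)).trans ?_
      rw [e1, min_eq_right (by omega)]
      simp [hS₁]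
  have h3 : (Prog.case (rs r : Stack R T) .skip .skip .skip).run N (update (update S (rs r)
      (List.replicate (s.reg r + 1 - N) true)) rtmp
        (List.replicate (min (s.reg r + 1) N) true)) =
      update (update S (rs r) []) rtmp (List.replicate (min (s.reg r + 1) N) true) := by
    rcases hle.lt_or_eq with hlt | heq
    · have e1 : s.reg r + 1 - N = 0 := by omega
      simp [Prog.run, e1]
    · have e1 : s.reg r + 1 - N = 1 := by omega
      rw [e1]
      simp only [Prog.run, ne_eq, reduceCtorEq, not_false_eq_true, update_of_ne, update_self,
        List.replicate_one]
      rw [update_comm (by simp), update_idem]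
  change (Prog.transfer rtmp (rs r : Stack R T)).run N ((Prog.case (rs r : Stack R T) .skip .skip
    .skip).run N ((Prog.transfer (rs r : Stack R T) rtmp).run N
      ((Prog.push (rs r : Stack R T) true).run N S))) = _
  rw [h1, h2, h3, Prog.run_transfer (n := min (s.reg r + 1) N) (m := 0) h0.symm _ (by simp)
    (by simp) (min_le_right _ _)]
  funext k
  by_cases hk : k = rs r
  · subst hk; simp
  · by_cases hk' : k = rtmp
    · subst hk'; simp [h.rtmp]
    · simp [hk, hk']

theorem run_restore {r r' : R} (hr : r ≠ r') (S : Stack R T → List Bool) {n m d : ℕ}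
    (hS : S (rs r) = List.replicate n true) (hS' : S (rs r') = List.replicate m true)
    (ht : S rtmp = List.replicate d true) (hd : d ≤ N) :
    (restore r r').run N S = update (update (update S (rs r) (List.replicate (n + d) true)) (rs r')
      (List.replicate (m + d) true)) rtmp [] := by
  refine iterate_eq_of_fixed (n := d) ?_ (by simp [Prog.run]) hd
  have key : ∀ j ≤ d, ((Prog.case (rtmp : Stack R T) (.seq (.push (rs r) true) (.push (rs r') true))
      .skip .skip).run N)^[j] S = update (update (update S (rs r) (List.replicate (n + j) true))
        (rs r') (List.replicate (m + j) true)) rtmp (List.replicate (d - j) true) := by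
    intro j hj
    induction j with
    | zero => simp [← hS, ← hS', ← ht]
    | succ j ih =>
      rw [iterate_succ_apply', ih (by omega)]
      obtain ⟨e, rfl⟩ : ∃ e, d = j + 1 + e := ⟨d - (j + 1), by omega⟩
      have h1 : j + 1 + e - j = e + 1 := by omega
      have h2 : j + 1 + e - (j + 1) = e := by omega
      rw [h1, h2]
      funext k
      rcases k with k | k | _ | _
      · by_cases hk : k = r
        · subst hk
          simp [Prog.run, hr, List.replicate_succ, ← add_assoc]
        · by_cases hk' : k = r'
          · subst hk'
            simp [Prog.run, hk, List.replicate_succ, ← add_assoc]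
          · simp [Prog.run, hk, hk', List.replicate_succ]
      all_goals simp [Prog.run, List.replicate_succ]
  simpa using key d le_rfl

/-- The test must leave the stacks exactly as they were: the `d = min n m` cancelled pairs are
counted on the scratch stack, and `restore` gives them back before either branch is run. -/
theorem run_compile_ifEq {S : Stack R T → List Bool} {s : State R T} (h : Rep N S s) (r r' : R)
    (p q : Cmd R T) : (compile (ifEq r r' p q)).run N S =
      if s.reg r = s.reg r' then (compile p).run N S else (compile q).run N S := by
  by_cases hr : r = r'
  · subst hr; simp [compile]
  have hle := h.reg_le r
  set n := s.reg r with hn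
  set m := s.reg r' with hm
  have key : ∀ j ≤ min n m, ((Prog.case (rs r : Stack R T) (.case (rs r') (.push rtmp true) .skip
      (.push (rs r) true)) .skip .skip).run N)^[j] S =
      update (update (update S (rs r) (List.replicate (n - j) true))
        (rs r') (List.replicate (m - j) true)) rtmp (List.replicate j true) := by
    intro j hj
    induction j with
    | zero => simp [hn, hm, ← h.reg, ← h.rtmp]
    | succ j ih =>
      rw [iterate_succ_apply', ih (by omega)]
      obtain ⟨d, hd⟩ : ∃ d, n - j = d + 1 := ⟨n - (j + 1), by omega⟩
      obtain ⟨e, he⟩ : ∃ e, m - j = e + 1 := ⟨m - (j + 1), by omega⟩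
      have h1 : n - (j + 1) = d := by omega
      have h2 : m - (j + 1) = e := by omega
      rw [h1, h2, hd, he]
      funext k
      rcases k with k | k | _ | _
      · by_cases hk : k = r
        · subst hk
          simp [Prog.run, hr, Ne.symm hr, List.replicate_succ]
        · by_cases hk' : k = r'
          · subst hk'
            simp [Prog.run, hk, Ne.symm hk, List.replicate_succ]
          · simp [Prog.run, hk, hk', hr, Ne.symm hr, List.replicate_succ]
      all_goals simp [Prog.run, hr, Ne.symm hr, List.replicate_succ]
  set d := min n m with hd
  set S' := update (update (update S (rs r) (List.replicate (n - d) true))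
        (rs r') (List.replicate (m - d) true)) rtmp (List.replicate d true) with hS'
  have hS'r : S' (rs r) = List.replicate (n - d) true := by simp [hS', hr]
  have hS'r' : S' (rs r') = List.replicate (m - d) true := by simp [hS']
  have h1 : (Prog.loop (.case (rs r : Stack R T) (.case (rs r') (.push rtmp true) .skip
      (.push (rs r) true)) .skip .skip)).run N S = S' := by
    -- After `d` rounds one of the stacks is empty. Further rounds do nothing, or pop an element of
    -- `r` and put it back.
    refine iterate_eq_of_fixed (n := d) (key d le_rfl) ?_ (by omega)
    rcases hnd : n - d with - | e
    · simp [Prog.run, hS'r, hnd]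
    · have hmd : m - d = 0 := by omega
      rw [hnd] at hS'r
      rw [hmd] at hS'r'
      have : update S' (rs r) (true :: List.replicate e true) = S' := by
        rw [← List.replicate_succ, ← hS'r, update_eq_self]
      simp [Prog.run, hS'r, hS'r', Ne.symm hr, List.replicate_succ, this]
  have h2 : (restore r r').run N S' = S := by
    rw [run_restore hr S' hS'r hS'r' (d := d) (by simp [hS']) (by omega)]
    have e1 : n - d + d = n := by omega
    have e2 : m - d + d = m := by omega
    rw [e1, e2]
    funext k
    rcases k with k | k | _ | _
    · by_cases hk : k = r
      · subst hk
        simp [hr, h.reg, hn]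
      · by_cases hk' : k = r'
        · subst hk'
          simp [h.reg, hm]
        · simp [hS', hk, hk']
    · simp [hS']
    · simp [h.rtmp]
    · simp [hS']
  simp only [compile, if_neg hr]
  rw [Prog.run, h1]
  rcases hnd : n - d with - | e
  · rcases hmd : m - d with - | f
    · have : n = m := by omega
      simp [Prog.run, hS'r, hS'r', hmd, h2, this]
    · have : n ≠ m := by omega
      have e1 : update S' (rs r') (true :: List.replicate f true) = S' := by
        rw [← List.replicate_succ, ← hmd, ← hS'r', update_eq_self]
      simp [Prog.run, hS'r, hS'r', hnd, hmd, h2, this, List.replicate_succ, e1]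
  · have : n ≠ m := by omega
    have e1 : update S' (rs r) (true :: List.replicate e true) = S' := by
      rw [← List.replicate_succ, ← hnd, ← hS'r, update_eq_self]
    simp [Prog.run, hS'r, hnd, h2, this, List.replicate_succ, e1]

/-- The stack program for a register program does what the register program does. -/
theorem rep_run_compile (c : Cmd R T) {S : Stack R T → List Bool} {s : State R T}
    (h : Rep N S s) : Rep N ((compile c).run N S) (c.eval N s) := by
  induction c generalizing S s with
  | skip => exact h
  | zero r =>
    rw [run_compile_zero h]
    exact h.setReg r (Nat.zero_le N)
  | inc r =>
    rw [run_compile_inc h]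
    exact h.setReg r (min_le_right _ _)
  | ifEq r r' p q ihp ihq =>
    rw [run_compile_ifEq h, eval]
    split_ifs
    · exact ihp h
    · exact ihq h
  | ifTab t x y z p q ihp ihq =>
    set i := Prog.index N (s.reg x) (s.reg y) (s.reg z) with hi
    set l := S (ts t) with hl
    have hlen : (Prog.paddedTake i l).length = i := Prog.length_paddedTake _ _
    -- The list that results from going to place `i` and back may be longer than `l`, but it has the
    -- same entries.
    have hrep : Rep N (update S (ts t) (Prog.paddedTake i l ++ l.drop i)) s := by
      refine h.update_tab t rfl (fun _ _ _ _ _ => Iff.rfl) fun x' y' z' hx' hy' hz' => ?_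
      rw [← h.tab t x' y' z' hx' hy' hz', Prog.getD_paddedTake_append]
      split_ifs with hlt
      · rfl
      · rw [List.getD_eq_getElem?_getD, List.getElem?_drop, ← List.getD_eq_getElem?_getD,
          Nat.add_sub_cancel' (by omega)]
    have hback := run_back h t x y z (l := l.drop i) (u := Prog.paddedTake i l) hlen
    have hgoto := run_goto h t x y z
    rw [← hi, ← hl] at hgoto
    set S' := update (update S (ts t) (l.drop i)) ttmp (Prog.paddedTake i l).reverse with hS'
    have hS't : S' (ts t) = l.drop i := by simp [hS']
    have hcond := h.tab t _ _ _ (h.reg_le x) (h.reg_le y) (h.reg_le z)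
    rw [← hi, ← hl] at hcond
    have hd : l.getD i false = (l.drop i).headD false := by
      rw [List.getD_eq_getElem?_getD, List.headD_eq_head?_getD, List.head?_drop]
    rw [hd] at hcond
    rw [eval, compile, Prog.run, hgoto]
    rcases hdrop : l.drop i with - | ⟨b, l'⟩
    · rw [hdrop] at hcond
      rw [if_neg (by rw [← hcond]; simp)]
      simp only [Prog.run, hS't, hdrop, hback]
      rw [hdrop] at hrep
      exact ihq hrep
    · have e1 : update S' (ts t) (b :: l') = S' := by rw [← hdrop, ← hS't, update_eq_self]
      rw [hdrop] at hcond hrep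
      cases b with
      | false =>
        rw [if_neg (by rw [← hcond]; simp)]
        simp only [Prog.run, hS't, hdrop, hback, update_self, update_idem, e1]
        exact ihq hrep
      | true =>
        rw [if_pos (by rw [← hcond]; simp)]
        simp only [Prog.run, hS't, hdrop, hback, update_self, update_idem, e1]
        exact ihp hrep
  | set t x y z =>
    set i := Prog.index N (s.reg x) (s.reg y) (s.reg z) with hi
    set l := S (ts t) with hl
    have hlen : (Prog.paddedTake i l).length = i := Prog.length_paddedTake _ _
    have hback := run_back h t x y z (l := true :: l.drop (i + 1)) (u := Prog.paddedTake i l) hlen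
    have hgoto := run_goto h t x y z
    rw [← hi, ← hl] at hgoto
    set S' := update (update S (ts t) (l.drop i)) ttmp (Prog.paddedTake i l).reverse with hS'
    have hS't : S' (ts t) = l.drop i := by simp [hS']
    have hpop : (Prog.case (ts t : Stack R T) .skip .skip .skip).run N S' =
        update S' (ts t) (l.drop (i + 1)) := by
      have : l.drop (i + 1) = (l.drop i).tail := by rw [List.tail_drop]
      rw [this, ← hS't]
      rcases hc : S' (ts t) with - | ⟨_ | _, l'⟩
      · have : update S' (ts t) [] = S' := by rw [← hc, update_eq_self]
        simp [Prog.run, hc, this]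
      · simp [Prog.run, hc]
      · simp [Prog.run, hc]
    have hpush : (Prog.push (ts t : Stack R T) true).run N (update S' (ts t) (l.drop (i + 1))) =
        update (update S (ts t) (true :: l.drop (i + 1))) ttmp
          (Prog.paddedTake i l).reverse := by
      simp only [Prog.run, hS', update_idem, update_self]
      rw [update_comm (by simp), update_idem]
    rw [eval, compile, Prog.run, hgoto, Prog.run, hpop, Prog.run, hpush, hback]
    refine h.update_tab t rfl (fun t' x' y' z' ht => by simp [State.setTab, ht])
      fun x' y' z' hx' hy' hz' => ?_
    rw [Prog.getD_paddedTake_append]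
    -- Different triples have different places, so no other entry is overwritten.
    have hind := Prog.index_inj (x := x') (x' := s.reg x) hy' hz' (h.reg_le y) (h.reg_le z)
    rw [← hi] at hind
    have htab := h.tab t x' y' z' hx' hy' hz'
    simp only [State.setTab, true_and, ← htab, ← hind]
    split_ifs with hlt
    · simp only [or_iff_left hlt.ne, hl]
    · obtain ⟨d, hd⟩ := Nat.exists_eq_add_of_le (not_lt.1 hlt)
      rw [hd, Nat.add_sub_cancel_left]
      cases d with
      | zero => simp
      | succ d =>
        rw [List.getD_cons_succ, List.getD_eq_getElem?_getD, List.getElem?_drop,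
          ← List.getD_eq_getElem?_getD, hl]
        have : i + 1 + d = i + (d + 1) := by omega
        simp [this]
  | seq p q ihp ihq => exact ihq (ihp h)
  | loop p ih =>
    have : ∀ n, Rep N (((compile p).run N)^[n] S) ((p.eval N)^[n] s) := by
      intro n
      induction n with
      | zero => exact h
      | succ n ihn =>
        rw [iterate_succ_apply', iterate_succ_apply']
        exact ih ihn
    exact this N

/-- The initial state for an input word, which is held by the table `inp`. -/
def init (inp : T) (w : List Bool) : State R T :=
  ⟨fun _ => 0, fun t x y z => t = inp ∧ w.getD (Prog.index w.length x y z) false = true⟩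

/-- A property that is decided by a register program is decidable in polynomial time. -/
theorem polyTimeDecidable [Fintype R] [Fintype T] {ι : Type} {enc : ι → List Bool} {P : ι → Prop}
    (c : Cmd R T) (inp out : T)
    (h : ∀ a, P a ↔ (c.eval (enc a).length (init inp (enc a))).tab out 0 0 0) :
    DFAClosure.PolyTimeDecidable enc P := by
  -- The machine delivers the input in reverse. It is put on the scratch stack `ttmp`, and one loop
  -- of moves restores its order in the table `inp` and leaves `ttmp` empty, as `Rep` demands.
  refine Prog.polyTimeDecidable
    (.seq (.loop (.move ttmp (ts inp))) (compile c)) ttmp (ts out : Stack R T) fun a => ?_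
  set w := enc a with hw
  set S₁ : Stack R T → List Bool := update (fun _ => []) ttmp w.reverse with hS₁
  have hload : (Prog.loop (.move ttmp (ts inp))).run w.length S₁ =
      update (fun _ : Stack R T => []) (ts inp) w := by
    refine (Prog.iterate_move (by simp) w.length S₁).trans ?_
    have := Prog.paddedTake_append (l := w.reverse) (l' := [])
    rw [List.append_nil, List.length_reverse] at this
    funext k
    by_cases hk : k = ts inp
    · subst hk
      simp [hS₁, this]
    · by_cases hk' : k = ttmp
      · subst hk'
        simp [hS₁]
      · simp [hS₁, hk, hk']
  have hrep : Rep w.length (update (fun _ : Stack R T => []) (ts inp) w)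
      (init (R := R) inp w) := by
    refine ⟨fun r => by simp [init], fun r => by simp [init], fun t x y z _ _ _ => ?_, by simp,
      by simp⟩
    by_cases ht : t = inp
    · subst ht
      simp [init]
    · simp [init, ht]
  have := (rep_run_compile c hrep).tab out 0 0 0 (Nat.zero_le _) (Nat.zero_le _) (Nat.zero_le _)
  rw [h a, ← this, Prog.run, hload]
  -- The entry `0 0 0` has place `0`, so it is the top of the stack `ts out`, which the machine
  -- returns.
  simp only [Prog.index, zero_mul, add_zero]
  rcases ((compile c).run w.length _) (ts out) with - | ⟨_ | _, l⟩ <;> simp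

end Cmd

end StackProgram

/-! ### Reasoning about loops of register programs -/

namespace StackProgram

open Function hiding eval

namespace Cmd

variable {R T : Type} [DecidableEq R] {N : ℕ}

theorem eval_seq (p q : Cmd R T) (s : State R T) :
    (seq p q).eval N s = q.eval N (p.eval N s) := rfl

/-- The predicate `Q` is preserved by the command `c`. -/
def Preserves (N : ℕ) (c : Cmd R T) (Q : State R T → Prop) : Prop :=
  ∀ s, Q s → Q (c.eval N s)

theorem Preserves.seq {p q : Cmd R T} {Q : State R T → Prop} (hp : Preserves N p Q)
    (hq : Preserves N q Q) : Preserves N (seq p q) Q := fun s h => hq _ (hp s h)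

theorem Preserves.iterate {p : Cmd R T} {Q : State R T → Prop} (hp : Preserves N p Q) (n : ℕ)
    {s : State R T} (h : Q s) : Q ((p.eval N)^[n] s) := by
  induction n with
  | zero => exact h
  | succ n ih =>
    rw [iterate_succ_apply']
    exact hp _ ih

theorem Preserves.loop {p : Cmd R T} {Q : State R T → Prop} (hp : Preserves N p Q) :
    Preserves N (loop p) Q := fun _ h => hp.iterate N h

/-- No command deletes an entry. Thus marks and a positive answer persist once they are made. -/
theorem preserves_tab (c : Cmd R T) (t : T) (x y z : ℕ) :
    Preserves N c fun s => s.tab t x y z := by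
  induction c with
  | skip | zero r | inc r => exact fun s h => h
  | ifEq r r' p q ihp ihq =>
    intro s h
    rw [eval]
    split_ifs
    · exact ihp s h
    · exact ihq s h
  | ifTab t x y z p q ihp ihq =>
    intro s h
    rw [eval]
    split_ifs
    · exact ihp s h
    · exact ihq s h
  | set t x y z => exact fun s h => Or.inl h
  | seq p q ihp ihq => exact fun s h => ihq _ (ihp s h)
  | loop p ih => exact fun s h => ih.iterate N h

/-- Run `p` for all values of the register `v` that are less than `N`. -/
def forReg (v : R) (p : Cmd R T) : Cmd R T := seq (zero v) (loop (seq p (inc v)))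

/-- Run `p` for all values of the registers `vs` that are less than `N`. -/
def forAll (vs : List R) (p : Cmd R T) : Cmd R T := vs.foldr forReg p

/-- The predicate `Q` does not depend on the register `v`. -/
def Irrelevant (v : R) (Q : State R T → Prop) : Prop := ∀ s n, Q s → Q (s.setReg v n)

theorem Preserves.forReg {v : R} {p : Cmd R T} {Q : State R T → Prop} (hv : Irrelevant v Q)
    (hp : Preserves N p Q) : Preserves N (forReg v p) Q :=
  Preserves.seq (fun s h => hv s _ h) (Preserves.loop (hp.seq fun s h => hv s _ h))

theorem Preserves.forAll {vs : List R} {p : Cmd R T} {Q : State R T → Prop}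
    (hv : ∀ v ∈ vs, Irrelevant v Q) (hp : Preserves N p Q) : Preserves N (forAll vs p) Q := by
  induction vs with
  | nil => exact hp
  | cons v vs ih =>
    exact Preserves.forReg (hv v (by simp)) (ih fun w hw => hv w (by simp [hw]))

/-- The invariant `I` lasts until the round in which `v` has the value `m`; this round establishes
`Q`, which survives all the later ones. -/
theorem forReg_hit {v : R} {p : Cmd R T} {I Q : State R T → Prop} (hIv : Irrelevant v I)
    (hIp : Preserves N p I) (hv : ∀ s, (p.eval N s).reg v = s.reg v) (hQv : Irrelevant v Q)
    (hQp : Preserves N p Q) {m : ℕ} (hm : m < N)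
    (hit : ∀ s, I s → s.reg v = m → Q (p.eval N s)) {s : State R T} (hs : I s) :
    Q ((forReg v p).eval N s) := by
  have hbody : ∀ j ≤ N, I (((Cmd.seq p (inc v)).eval N)^[j] (s.setReg v 0)) ∧
      (((Cmd.seq p (inc v)).eval N)^[j] (s.setReg v 0)).reg v = j := by
    intro j hj
    induction j with
    | zero => exact ⟨hIv s 0 hs, by simp [State.setReg]⟩
    | succ j ih =>
      obtain ⟨h1, h2⟩ := ih (by omega)
      rw [iterate_succ_apply']
      refine ⟨hIv _ _ (hIp _ h1), ?_⟩
      set s' := ((Cmd.seq p (inc v)).eval N)^[j] (s.setReg v 0)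
      simp only [eval, State.setReg, update_self, hv, h2]
      omega
  obtain ⟨h1, h2⟩ := hbody m hm.le
  have h3 : Q (((Cmd.seq p (inc v)).eval N)^[m + 1] (s.setReg v 0)) := by
    rw [iterate_succ_apply']
    exact hQv _ _ (hit _ h1 h2)
  obtain ⟨d, hd⟩ := Nat.exists_eq_add_of_le (Nat.succ_le_of_lt hm)
  have h4 := Preserves.iterate (hQp.seq (q := inc v) fun s h => hQv s _ h) d h3
  rw [← iterate_add_apply] at h4
  have : d + (m + 1) = N := by omega
  rwa [this] at h4

/-- If the body of a nest of loops establishes `Q` for some values of the loop registers, and if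
`Q` is preserved, then it holds in the end. -/
theorem forAll_hit {vs : List R} (hvs : vs.Nodup) {p : Cmd R T} {I Q : State R T → Prop}
    (hp : ∀ s, (p.eval N s).reg = s.reg)
    (hIv : ∀ v ∈ vs, Irrelevant v I) (hIp : Preserves N p I)
    (hQv : ∀ v ∈ vs, Irrelevant v Q) (hQp : Preserves N p Q) {f : R → ℕ} (hf : ∀ v ∈ vs, f v < N)
    (hit : ∀ s, I s → (∀ v ∈ vs, s.reg v = f v) → Q (p.eval N s)) {s : State R T} (hs : I s) :
    Q ((forAll vs p).eval N s) := by
  induction vs generalizing I s with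
  | nil => exact hit s hs (by simp)
  | cons v vs ih =>
    obtain ⟨hv, hvs⟩ := List.nodup_cons.1 hvs
    have hreg : ∀ m, ∀ w ∈ vs, Irrelevant w fun s : State R T => s.reg v = m := by
      rintro m w hw s n h
      have : v ≠ w := by rintro rfl; exact hv hw
      simpa [State.setReg, this] using h
    refine forReg_hit (hIv v (by simp))
      (Preserves.forAll (fun w hw => hIv w (by simp [hw])) hIp) (fun s => ?_) (hQv v (by simp))
      (Preserves.forAll (fun w hw => hQv w (by simp [hw])) hQp) (hf v (by simp)) (fun s h hm => ?_)
      hs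
    · exact Preserves.forAll (Q := fun s' => s'.reg v = s.reg v) (hreg _)
        (fun s' h => (congrFun (hp s') v).trans h) s rfl
    -- The value of the outer loop register becomes part of the invariant of the inner loops.
    · refine ih hvs (I := fun s => I s ∧ s.reg v = f v)
        (fun w hw s n h => ⟨hIv w (by simp [hw]) s n h.1, hreg _ w hw s n h.2⟩)
        (fun s h => ⟨hIp s h.1, by rw [hp]; exact h.2⟩) (fun w hw => hQv w (by simp [hw]))
        (fun w hw => hf w (by simp [hw])) (fun s h h' => hit s h.1 fun w hw => ?_) ⟨h, hm⟩
      rcases List.mem_cons.1 hw with rfl | hw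
      · exact h.2
      · exact h' w hw

/-- Run `p` until the register `r` has the value of `r'`. -/
def untilEq (r r' : R) (p : Cmd R T) : Cmd R T := loop (ifEq r r' skip p)

/-- `J j` describes the state after `j` rounds. Once `r` has reached `B`, the test succeeds and the
remaining rounds are idle. -/
theorem eval_untilEq {r r' : R} {p : Cmd R T} {B : ℕ} (hB : B ≤ N) (J : ℕ → State R T → Prop)
    (hJ : ∀ j s, J j s → s.reg r = j ∧ s.reg r' = B)
    (step : ∀ j s, j < B → J j s → J (j + 1) (p.eval N s)) {s : State R T} (h0 : J 0 s) :
    J B ((untilEq r r' p).eval N s) := by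
  have key : ∀ j ≤ B, J j (((ifEq r r' skip p).eval N)^[j] s) := by
    intro j hj
    induction j with
    | zero => exact h0
    | succ j ih =>
      have h := ih (by omega)
      obtain ⟨h1, h2⟩ := hJ _ _ h
      rw [iterate_succ_apply', eval, if_neg (by rw [h1, h2]; omega)]
      exact step j _ (by omega) h
  have h := key B le_rfl
  obtain ⟨h1, h2⟩ := hJ _ _ h
  have : (untilEq r r' p).eval N s = ((ifEq r r' skip p).eval N)^[B] s := by
    refine iterate_eq_of_fixed rfl ?_ hB
    rw [eval, if_pos (by rw [h1, h2]), eval]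
  rw [this]
  exact h

end Cmd

/-! ### Parsing the description of an automaton -/

/-- The registers of the decision procedure. -/
inductive Register
  | null | pos | done | letters | states | start | state | letter | value | x | y | x' | y'
  deriving DecidableEq

/-- The tables of the decision procedure. -/
inductive Table
  | input | final | trans | reach | pairs | answer
  deriving DecidableEq

instance : Fintype Register where
  elems := {.null, .pos, .done, .letters, .states, .start, .state, .letter, .value, .x, .y, .x', .y'}
  complete r := by cases r <;> simp

instance : Fintype Table where
  elems := {.input, .final, .trans, .reach, .pairs, .answer}
  complete t := by cases t <;> simp

open Register Table Cmd DFAClosure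

/-- Read a number in the code `unary`. -/
def readUnary (r : Register) : Cmd Register Table :=
  .seq (.zero r) (.seq (.zero done) (.loop (.ifEq done null
    (.seq (.ifTab input null null pos (.inc r) (.inc done)) (.inc pos)) .skip)))

/-- Read the row of a transition table. -/
def readRow : Cmd Register Table :=
  .seq (.zero letter) (untilEq letter letters
    (.seq (readUnary value) (.seq (.set trans state letter value) (.inc letter))))

/-- Read the description of an automaton. -/
def readDFA : Cmd Register Table :=
  .seq (readUnary letters) (.seq (readUnary states) (.seq (readUnary start)
    (.seq (.zero state) (untilEq state states
      (.seq (.ifTab input null null pos (.set final state null null) .skip)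
        (.seq (.inc pos) (.seq readRow (.inc state))))))))

variable {w : List Bool}

/-- The input word `w` is available in the state `s`. -/
structure HasInput (w : List Bool) (s : State Register Table) : Prop where
  null_eq : s.reg null = 0
  input_iff : ∀ j, s.tab input 0 0 j ↔ w.getD j false = true

theorem eval_readUnary {s : State Register Table} (h : HasInput w s) {r : Register}
    (hr : r ≠ null ∧ r ≠ pos ∧ r ≠ done) {m : ℕ} {rest : List Bool}
    (hw : w.drop (s.reg pos) = unary m ++ rest) :
    (readUnary r).eval w.length s =
      ⟨update (update (update s.reg r m) done 1) pos (s.reg pos + (m + 1)), s.tab⟩ := by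
  obtain ⟨hr0, hrp, hrd⟩ := hr
  -- The code lies within the input, so none of the increments below saturates.
  have hlen : s.reg pos + (m + 1) ≤ w.length := by
    have := congrArg List.length hw
    simp [unary] at this
    omega
  have hget : ∀ j, w.getD (s.reg pos + j) false = (unary m ++ rest).getD j false := fun j => by
    rw [← hw, List.getD_eq_getElem?_getD, List.getD_eq_getElem?_getD, List.getElem?_drop]
  set body : Cmd Register Table := .ifEq done null
    (.seq (.ifTab Table.input null null pos (.inc r) (.inc done)) (.inc pos))
    .skip with hbody
  have key : ∀ j ≤ m, (body.eval w.length)^[j] ((s.setReg r 0).setReg done 0) =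
      ⟨update (update (update s.reg r j) done 0) pos (s.reg pos + j), s.tab⟩ := by
    intro j hj
    induction j with
    | zero =>
      simp only [iterate_zero, id, State.setReg, add_zero]
      congr 1
      funext k
      by_cases hk : k = pos
      · subst hk
        simp [Ne.symm hrp]
      · simp [hk]
    | succ j ih =>
      rw [iterate_succ_apply', ih (by omega), hbody, eval, if_pos (by simp [Ne.symm hr0, h.null_eq]),
        eval, eval, eval, if_pos]
      · simp only [eval, State.setReg]
        congr 1
        funext k
        by_cases hk : k = pos
        · subst hk
          simp [Ne.symm hrp]
          omega
        · by_cases hk' : k = done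
          · subst hk'
            simp [Ne.symm hrd]
          · by_cases hk'' : k = r
            · subst hk''
              simp [hk, hk']
              omega
            · simp [hk, hk', hk'']
      · have : (unary m ++ rest).getD j false = true := by
          rw [List.getD_append _ _ _ _ (by simp [unary]; omega)]
          simp [unary, List.getElem?_append, show j < m by omega]
        rw [← hget] at this
        simpa [Ne.symm hr0, h.null_eq, h.input_iff] using this
  -- There are `m` rounds for the bits `true` and one for the final `false`, which sets `done` and
  -- thereby makes the other rounds idle.
  refine iterate_eq_of_fixed (n := m + 1) ?_ ?_ (by omega)
  · rw [iterate_succ_apply']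
    change body.eval w.length ((body.eval w.length)^[m] ((s.setReg r 0).setReg done 0)) = _
    rw [key m le_rfl, hbody, eval, if_pos (by simp [Ne.symm hr0, h.null_eq]), eval, eval,
      eval, if_neg]
    · simp only [eval, State.setReg]
      congr 1
      funext k
      by_cases hk : k = pos
      · subst hk
        simp
        omega
      · by_cases hk' : k = done
        · subst hk'
          simp
          omega
        · simp [hk, hk']
    · have : (unary m ++ rest).getD m false = false := by
        rw [List.getD_append _ _ _ _ (by simp [unary])]
        simp [unary]
      rw [← hget] at this
      simpa [Ne.symm hr0, h.null_eq, h.input_iff] using this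
  · rw [eval, if_neg (by simp [Ne.symm hr0, h.null_eq]), eval]

theorem exists_eval_readUnary {s : State Register Table} (h : HasInput w s) {r : Register}
    (hr : r ≠ null ∧ r ≠ pos ∧ r ≠ done) {m : ℕ} {rest : List Bool}
    (hw : w.drop (s.reg pos) = unary m ++ rest) :
    ∃ s', (readUnary r).eval w.length s = s' ∧ HasInput w s' ∧ s'.tab = s.tab ∧
      w.drop (s'.reg pos) = rest ∧ s'.reg r = m ∧
      ∀ r', r' ≠ r → r' ≠ done → r' ≠ pos → s'.reg r' = s.reg r' := by
  refine ⟨_, eval_readUnary h hr hw, ⟨?_, h.input_iff⟩, rfl, ?_, ?_, fun r' h1 h2 h3 => ?_⟩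
  · simp [hr.1.symm, h.null_eq]
  · simp only [update_self]
    rw [← List.drop_drop, hw]
    exact List.drop_left' (by simp [unary])
  · simp [hr]
  · simp [h1, h2, h3]

theorem eval_readRow {s : State Register Table} (h : HasInput w s) {k : ℕ} (g : Fin k → ℕ)
    (hk : s.reg letters = k) (hkw : k ≤ w.length) {rest : List Bool}
    (hw : w.drop (s.reg pos) = (List.finRange k).flatMap (fun a => unary (g a)) ++ rest) :
    ∃ s', readRow.eval w.length s = s' ∧ w.drop (s'.reg pos) = rest ∧
      (∀ r, r ≠ pos → r ≠ done → r ≠ letter → r ≠ value → s'.reg r = s.reg r) ∧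
      (∀ t, t ≠ trans → s'.tab t = s.tab t) ∧
      ∀ x y z, s'.tab trans x y z ↔
        s.tab trans x y z ∨ x = s.reg state ∧ ∃ a, y = (a : Fin k) ∧ z = g a := by
  -- After `j` rounds the transitions of the first `j` letters are in the table, and the codes of
  -- the others lie ahead of `pos`.
  let J : ℕ → State Register Table → Prop := fun j s' => s'.reg letter = j ∧
    w.drop (s'.reg pos) = ((List.finRange k).drop j).flatMap (fun a => unary (g a)) ++ rest ∧
    (∀ r, r ≠ pos → r ≠ done → r ≠ letter → r ≠ value → s'.reg r = s.reg r) ∧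
    (∀ t, t ≠ trans → s'.tab t = s.tab t) ∧
    ∀ x y z, s'.tab trans x y z ↔
      s.tab trans x y z ∨ x = s.reg state ∧ ∃ a, (a : Fin k) < j ∧ y = a ∧ z = g a
  have key : J k (readRow.eval w.length s) := by
    refine eval_untilEq hkw J ?_ ?_ ?_
    · rintro j s' ⟨h1, -, h3, -⟩
      exact ⟨h1, by rw [h3 _ (by simp) (by simp) (by simp) (by simp), hk]⟩
    · rintro j s' hj ⟨h1, h2, h3, h4, h5⟩
      have h' : HasInput w s' := by
        refine ⟨?_, fun i => ?_⟩
        · rw [h3 _ (by simp) (by simp) (by simp) (by simp), h.null_eq]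
        · rw [h4 _ (by simp), h.input_iff]
      rw [List.drop_eq_getElem_cons (l := List.finRange k) (by simpa using hj), List.flatMap_cons,
        List.append_assoc,
        List.getElem_finRange] at h2
      simp only [Fin.cast_mk] at h2
      rw [eval, eval_readUnary h' (by simp) h2]
      refine ⟨?_, ?_, ?_, ?_, ?_⟩
      · simp [eval, State.setReg, State.setTab, h1]
        omega
      · have := congrArg (List.drop (g ⟨j, hj⟩ + 1)) h2
        rw [List.drop_drop] at this
        simp only [eval, State.setReg, State.setTab, ne_eq, reduceCtorEq, not_false_eq_true,
          update_of_ne, update_self]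
        rw [this]
        exact List.drop_left' (by simp [unary])
      · intro r hr1 hr2 hr3 hr4
        simp [eval, State.setReg, State.setTab, hr1, hr2, hr3, hr4, h3]
      · intro t ht
        simp [eval, State.setReg, State.setTab, ht, h4]
      · intro x y z
        have hst : s'.reg state = s.reg state := h3 _ (by simp) (by simp) (by simp) (by simp)
        simp only [eval, State.setReg, State.setTab, ne_eq, reduceCtorEq, not_false_eq_true,
          update_of_ne, update_self, true_and, h5, h1, hst]
        constructor
        · rintro ((h | ⟨hx, a, ha, hy, hz⟩) | ⟨hx, hy, hz⟩)
          · exact Or.inl h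
          · exact Or.inr ⟨hx, a, by omega, hy, hz⟩
          · exact Or.inr ⟨hx, ⟨j, hj⟩, by simp, hy, hz⟩
        · rintro (h | ⟨hx, a, ha, hy, hz⟩)
          · exact Or.inl (Or.inl h)
          · rcases (Nat.lt_succ_iff_lt_or_eq.1 ha) with ha | ha
            · exact Or.inl (Or.inr ⟨hx, a, ha, hy, hz⟩)
            · subst ha
              exact Or.inr ⟨hx, hy, hz⟩
    · refine ⟨by simp [eval, State.setReg], by simpa [eval, State.setReg] using hw, ?_, ?_, ?_⟩
      · intro r hr1 hr2 hr3 hr4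
        simp [eval, State.setReg, hr3]
      · intro t ht
        simp [eval, State.setReg]
      · intro x y z
        simp [eval, State.setReg]
  obtain ⟨-, h2, h3, h4, h5⟩ := key
  refine ⟨_, rfl, ?_, h3, h4, fun x y z => ?_⟩
  · rw [h2, List.drop_of_length_le (by simp)]
    rfl
  · rw [h5]
    refine or_congr_right (and_congr_right fun _ => exists_congr fun a => ?_)
    simp [a.isLt]

/-- The automaton `M` is available in the state `s`. -/
structure HasDFA {k n : ℕ} (M : DFA (Fin k) (Fin n)) (s : State Register Table) : Prop where
  null_eq : s.reg null = 0
  start_eq : s.reg start = M.start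
  final_iff : ∀ x, s.tab final x 0 0 ↔ ∃ q ∈ M.accept, x = (q : Fin n)
  trans_iff : ∀ x y z, s.tab trans x y z ↔ ∃ q a, x = (q : Fin n) ∧ y = (a : Fin k) ∧ z = M.step q a

theorem eval_readDFA (M : FiniteDFA) {s : State Register Table}
    (hs : s = readDFA.eval M.encode.length (init input M.encode)) :
    HasDFA M.dfa s ∧ (∀ x y z, ¬ s.tab reach x y z) ∧ (∀ x y z, ¬ s.tab pairs x y z) ∧
      (∀ x y z, ¬ s.tab answer x y z) := by
  classical
  obtain ⟨k, n, M⟩ := M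
  set w := FiniteDFA.encode ⟨k, n, M⟩ with hw
  simp only [FiniteDFA.encode] at hw
  -- Both numbers are written in unary, so loops of `w.length` rounds are long enough to read all
  -- rows and all their entries.
  have hkw : k ≤ w.length ∧ n ≤ w.length := by
    rw [hw]
    simp [unary]
    omega
  set s₀ : State Register Table := init input w with hs₀
  have h₀ : HasInput w s₀ := ⟨rfl, fun j => by simp [hs₀, init, Prog.index]⟩
  have htab : ∀ t, t ≠ input → ∀ x y z, ¬ s₀.tab t x y z := by
    intro t ht x y z
    simp [hs₀, init, ht]
  obtain ⟨s₁, e₁, h₁, ht₁, hw₁, hr₁, hf₁⟩ := exists_eval_readUnary (r := letters) h₀ (by simp) hw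
  obtain ⟨s₂, e₂, h₂, ht₂, hw₂, hr₂, hf₂⟩ := exists_eval_readUnary (r := states) h₁ (by simp) hw₁
  obtain ⟨s₃, e₃, h₃, ht₃, hw₃, hr₃, hf₃⟩ := exists_eval_readUnary (r := start) h₂ (by simp) hw₂
  rw [readDFA, eval, e₁, eval, e₂, eval, e₃, eval] at hs
  have hk : s₃.reg letters = k := by simp [hf₃, hf₂, hr₁]
  have hn : s₃.reg states = n := by simp [hf₃, hr₂]
  rw [← ht₁, ← ht₂, ← ht₃] at htab
  -- After `j` rounds the first `j` states have been read. The last clause says that the work tables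
  -- are still empty, which the searches rely on.
  let J : ℕ → State Register Table → Prop := fun j s => s.reg state = j ∧ HasInput w s ∧
    s.reg letters = k ∧ s.reg states = n ∧ s.reg start = M.start ∧
    w.drop (s.reg pos) = ((List.finRange n).drop j).flatMap (fun q => decide (q ∈ M.accept) ::
        (List.finRange k).flatMap fun a => unary (M.step q a)) ∧
    (∀ x, s.tab final x 0 0 ↔ ∃ q ∈ M.accept, (q : Fin n) < j ∧ x = q) ∧
    (∀ x y z, s.tab trans x y z ↔
      ∃ q a, (q : Fin n) < j ∧ x = q ∧ y = (a : Fin k) ∧ z = M.step q a) ∧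
    ∀ t, t = reach ∨ t = pairs ∨ t = answer → ∀ x y z, ¬ s.tab t x y z
  have key : J n s := by
    rw [hs]
    refine eval_untilEq hkw.2 J ?_ ?_ ?_
    · rintro j s ⟨h1, -, -, h4, -⟩
      exact ⟨h1, h4⟩
    · rintro j s hj ⟨h1, h2, h3, h4, h5, h6, h7, h8, h9⟩
      rw [List.drop_eq_getElem_cons (l := List.finRange n) (by simpa using hj), List.flatMap_cons,
        List.getElem_finRange] at h6
      simp only [Fin.cast_mk, List.cons_append] at h6
      have hlt : s.reg pos < w.length := by
        have := congrArg List.length h6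
        simp at this
        omega
      have hget : w.getD (s.reg pos) false = decide (⟨j, hj⟩ ∈ M.accept) := by
        rw [List.getD_eq_getElem?_getD, ← add_zero (s.reg pos), ← List.getElem?_drop, h6]
        simp
      -- The state after the finality bit of state `j` and before its row.
      set s' := (Cmd.inc pos).eval w.length ((Cmd.ifTab input null null pos
        (.set Table.final state null null) .skip).eval w.length s) with hs'
      have hreg' : s'.reg = update s.reg pos (s.reg pos + 1) := by
        rw [hs', eval, eval]
        split_ifs <;> simp [eval, State.setReg, State.setTab, min_eq_left (Nat.succ_le_of_lt hlt)]
      have htab' : ∀ t, t ≠ Table.final → s'.tab t = s.tab t := by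
        intro t ht
        rw [hs', eval, eval]
        split_ifs <;> simp [eval, State.setReg, State.setTab, ht]
      have hfinal' : ∀ x, s'.tab Table.final x 0 0 ↔
          s.tab Table.final x 0 0 ∨ x = j ∧ ⟨j, hj⟩ ∈ M.accept := by
        intro x
        have hb := h2.input_iff (s.reg pos)
        rw [hget, decide_eq_true_iff] at hb
        rw [hs', eval, eval]
        split_ifs with hif
        · rw [h2.null_eq, hb] at hif
          simp [eval, State.setReg, State.setTab, hif, h2.null_eq, h1]
        · rw [h2.null_eq, hb] at hif
          simp [eval, State.setReg, hif]
      have hin' : HasInput w s' :=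
        ⟨by simp [hreg', h2.null_eq], fun i => by rw [htab' _ (by simp), h2.input_iff]⟩
      have h6' : w.drop (s'.reg pos) = (List.finRange k).flatMap
          (fun a => unary (M.step ⟨j, hj⟩ a)) ++ ((List.finRange n).drop (j + 1)).flatMap
          (fun q => decide (q ∈ M.accept) ::
          (List.finRange k).flatMap fun a => unary (M.step q a)) := by
        have := congrArg List.tail h6
        rw [List.tail_drop] at this
        simp only [hreg', update_self, this, List.tail_cons]
      obtain ⟨s'', hs'', g1, g2, g3, g4⟩ := eval_readRow hin' (fun a => (M.step ⟨j, hj⟩ a : ℕ))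
        (by simpa [hreg'] using h3) hkw.1 h6'
      have hgoal : ∀ r, r ≠ pos → r ≠ done → r ≠ letter → r ≠ value →
          s''.reg r = s.reg r := by
        intro r hr1 hr2 hr3 hr4
        rw [g2 r hr1 hr2 hr3 hr4, hreg', update_of_ne hr1]
      rw [eval_seq, eval_seq, ← hs', eval_seq, hs'', eval]
      refine ⟨?_, ⟨?_, ?_⟩, ?_, ?_, ?_, ?_, ?_, ?_, ?_⟩
      · simp [State.setReg, hgoal, h1]
        omega
      · simp [State.setReg, hgoal, h2.null_eq]
      · intro i
        simp only [State.setReg, g3 Table.input (by simp)]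
        exact hin'.input_iff i
      · simp [State.setReg, hgoal, h3]
      · simp [State.setReg, hgoal, h4]
      · simp [State.setReg, hgoal, h5]
      · simpa [State.setReg] using g1
      · intro x
        simp only [State.setReg, g3 Table.final (by simp), hfinal', h7]
        constructor
        · rintro (⟨q, hq, hqj, rfl⟩ | ⟨rfl, hq⟩)
          · exact ⟨q, hq, by omega, rfl⟩
          · exact ⟨_, hq, by simp, rfl⟩
        · rintro ⟨q, hq, hqj, rfl⟩
          rcases Nat.lt_succ_iff_lt_or_eq.1 hqj with h | h
          · exact Or.inl ⟨q, hq, h, rfl⟩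
          · subst h
            exact Or.inr ⟨rfl, hq⟩
      · intro x y z
        simp only [State.setReg, g4, htab' Table.trans (by simp), h8, hreg', ne_eq, reduceCtorEq,
          not_false_eq_true, update_of_ne, h1]
        constructor
        · rintro (⟨q, a, hqj, hx, hy, hz⟩ | ⟨rfl, a, hy, hz⟩)
          · exact ⟨q, a, by omega, hx, hy, hz⟩
          · exact ⟨⟨x, hj⟩, a, by simp, rfl, hy, hz⟩
        · rintro ⟨q, a, hqj, hx, hy, hz⟩
          rcases Nat.lt_succ_iff_lt_or_eq.1 hqj with h | h
          · exact Or.inl ⟨q, a, h, hx, hy, hz⟩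
          · subst h
            exact Or.inr ⟨hx, a, hy, hz⟩
      · intro t ht x y z
        have : t ≠ Table.trans ∧ t ≠ Table.final := by rcases ht with rfl | rfl | rfl <;> simp
        simp only [State.setReg, g3 t this.1, htab' t this.2]
        exact h9 t ht x y z
    · refine ⟨by simp [eval, State.setReg], ⟨by simp [eval, State.setReg, h₃.null_eq], h₃.input_iff⟩,
        by simpa [eval, State.setReg] using hk, by simpa [eval, State.setReg] using hn,
        by simpa [eval, State.setReg] using hr₃, by simpa [eval, State.setReg] using hw₃,
        fun x => ?_, fun x y z => ?_, fun t ht x y z => ?_⟩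
      · simp [eval, State.setReg, htab]
      · simp [eval, State.setReg, htab]
      · have : t ≠ Table.input := by rcases ht with rfl | rfl | rfl <;> simp
        simp [eval, State.setReg, htab, this]
  obtain ⟨-, h2, -, -, h5, -, h7, h8, h9⟩ := key
  refine ⟨⟨h2.null_eq, h5, fun x => ?_, fun x y z => ?_⟩, h9 _ (by simp), h9 _ (by simp),
    h9 _ (by simp)⟩
  · rw [h7]
    simp
  · rw [h8]
    simp

end StackProgram

/-! ### Automata: failure of closure as a reachability problem -/

namespace DFAClosure

variable {α σ : Type*}

/-- A prefix arises by deleting last letters one at a time, so closure under a single deletion is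
enough. -/
theorem not_isPrefixClosed_accepts_iff (M : DFA α σ) : ¬ IsPrefixClosed M.accepts ↔
    ∃ w a, M.eval w ∉ M.accept ∧ M.eval (w ++ [a]) ∈ M.accept := by
  rw [← not_iff_not, not_not]
  push Not
  constructor
  · intro h w a hw hwa
    refine hw ?_
    have : w ∈ pref M.accepts := ⟨w ++ [a], hwa, List.prefix_append _ _⟩
    rwa [← h] at this
  · intro h
    refine Set.Subset.antisymm (fun x hx => ⟨x, hx, List.prefix_rfl⟩) ?_
    rintro x ⟨w, hw, u, rfl⟩
    induction u using List.reverseRecOn with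
    | nil =>
      rw [List.append_nil] at hw
      exact hw
    | append_singleton u a ih =>
      refine ih ?_
      by_contra hu
      exact h (x ++ u) a hu (by rw [List.append_assoc]; exact hw)

/-- Likewise for first letters. The same word `w` is read from two states, so the condition concerns
pairs of states. -/
theorem not_isSuffixClosed_accepts_iff (M : DFA α σ) : ¬ IsSuffixClosed M.accepts ↔
    ∃ w a, M.evalFrom (M.step M.start a) w ∈ M.accept ∧ M.eval w ∉ M.accept := by
  rw [← not_iff_not, not_not]
  push Not
  constructor
  · intro h w a hwa
    have : w ∈ suff M.accepts := ⟨a :: w, hwa, List.suffix_cons _ _⟩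
    rwa [← h] at this
  · intro h
    refine Set.Subset.antisymm (fun x hx => ⟨x, hx, List.suffix_rfl⟩) ?_
    rintro x ⟨w, hw, u, rfl⟩
    induction u with
    | nil => exact hw
    | cons a u ih => exact ih (h (u ++ x) a hw)

/-- A factor is a suffix of a prefix, and prefixes and suffixes are factors. -/
theorem isFactorial_iff {L : Language α} :
    IsFactorial L ↔ IsPrefixClosed L ∧ IsSuffixClosed L := by
  constructor
  · intro h
    refine ⟨Set.Subset.antisymm (fun x hx => ⟨x, hx, List.prefix_rfl⟩) ?_,
      Set.Subset.antisymm (fun x hx => ⟨x, hx, List.suffix_rfl⟩) ?_⟩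
    · rintro x ⟨w, hw, hx⟩
      have : x ∈ fact L := ⟨w, hw, hx.isInfix⟩
      rwa [← h] at this
    · rintro x ⟨w, hw, hx⟩
      have : x ∈ fact L := ⟨w, hw, hx.isInfix⟩
      rwa [← h] at this
  · rintro ⟨hp, hs⟩
    refine Set.Subset.antisymm (fun x hx => ⟨x, hx, List.infix_rfl⟩) ?_
    rintro x ⟨w, hw, u, v, rfl⟩
    have h1 : u ++ x ∈ pref L := ⟨_, hw, List.prefix_append _ _⟩
    rw [← hp] at h1
    have h2 : x ∈ suff L := ⟨_, h1, List.suffix_append _ _⟩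
    rwa [← hs] at h2

theorem exists_short_evalFrom_eq [Fintype σ] (M : DFA α σ) (s : σ) (w : List α) :
    ∃ w', w'.length ≤ Fintype.card σ ∧ M.evalFrom s w' = M.evalFrom s w := by
  induction hn : w.length using Nat.strong_induction_on generalizing w with
  | _ n ih =>
    by_cases hle : w.length ≤ Fintype.card σ
    · exact ⟨w, hle, rfl⟩
    · obtain ⟨q, a, b, c, rfl, -, hb, h1, h2, h3⟩ := M.evalFrom_split (not_le.1 hle).le rfl
      -- Pumping down: the run on `b` is a nonempty cycle, which is cut out.
      have hlen : 0 < b.length := List.length_pos_of_ne_nil hb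
      obtain ⟨w', hw', h⟩ := ih (a ++ c).length (by simp at hn ⊢; omega) (a ++ c) rfl
      refine ⟨w', hw', h.trans ?_⟩
      rw [M.evalFrom_of_append, h1, h3]

/-- The automaton that runs an automaton on two states in parallel. -/
def pairDFA (M : DFA α σ) : DFA α (σ × σ) :=
  ⟨fun p a => (M.step p.1 a, M.step p.2 a), (M.start, M.start), ∅⟩

theorem evalFrom_pairDFA (M : DFA α σ) (p q : σ) (w : List α) :
    (pairDFA M).evalFrom (p, q) w = (M.evalFrom p w, M.evalFrom q w) := by
  induction w generalizing p q with
  | nil => rfl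
  | cons a w ih => exact ih _ _

end DFAClosure

/-! ### The decision procedures and their correctness -/

namespace StackProgram

open Function hiding eval
open Register Table Cmd DFAClosure

variable {k n N : ℕ} {M : DFA (Fin k) (Fin n)} {s : State Register Table}

theorem HasDFA.setTab (h : HasDFA M s) {t : Table} (ht : t ≠ final ∧ t ≠ trans) (i j l : ℕ) :
    HasDFA M (s.setTab t i j l) :=
  ⟨h.null_eq, h.start_eq, by simpa [State.setTab, ht.1.symm] using h.final_iff,
    by simpa [State.setTab, ht.2.symm] using h.trans_iff⟩

theorem HasDFA.setReg (h : HasDFA M s) {r : Register} (hr : r ≠ null ∧ r ≠ start) (m : ℕ) :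
    HasDFA M (s.setReg r m) :=
  ⟨by simpa [State.setReg, hr.1.symm] using h.null_eq,
    by simpa [State.setReg, hr.2.symm] using h.start_eq, h.final_iff, h.trans_iff⟩

/-- Run `p` if an entry of a table is set. -/
def when (t : Table) (i j l : Register) (p : Cmd Register Table) : Cmd Register Table :=
  .ifTab t i j l p .skip

/-- Mark the successors of the marked states. -/
def reachStep : Cmd Register Table := forAll [x, letter, y]
  (when reach x null null (when trans x letter y (.set reach y null null)))

/-- Search a transition from a marked state that is not final to a final state. -/
def reachAnswer : Cmd Register Table := forAll [x, letter, y]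
  (when reach x null null (when trans x letter y (.ifTab final x null null .skip
    (when final y null null (.set answer null null null)))))

/-- Decide whether the language of an automaton is not prefix-closed. -/
def decidePrefix : Cmd Register Table :=
  .seq (.set reach start null null) (.seq (.loop reachStep) reachAnswer)

/-- The marked states are reachable, and the answer is correct if it is positive. -/
structure ReachInv (M : DFA (Fin k) (Fin n)) (P : ℕ → ℕ → ℕ → Prop) (A : Prop)
    (s : State Register Table) : Prop where
  dfa : HasDFA M s
  reach : ∀ x y z, s.tab reach x y z → ∃ w, x = M.eval w
  pairs : s.tab pairs = P
  answer : s.tab answer 0 0 0 → A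

theorem ReachInv.irrelevant {P : ℕ → ℕ → ℕ → Prop} {A : Prop} {r : Register}
    (hr : r ≠ null ∧ r ≠ start) : Irrelevant r (ReachInv M P A) :=
  fun _ m h => ⟨h.dfa.setReg hr m, h.reach, h.pairs, h.answer⟩

theorem preserves_reachStep {P : ℕ → ℕ → ℕ → Prop} {A : Prop} :
    Preserves N reachStep (ReachInv M P A) := by
  refine Preserves.forAll (fun v hv => ReachInv.irrelevant (by
    constructor <;> rintro rfl <;> simp at hv)) fun s h => ?_
  simp only [when, eval]
  split_ifs with h1 h2
  · refine ⟨h.dfa.setTab (by simp) _ _ _, fun x y z hx => ?_, ?_, ?_⟩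
    · rcases hx with hx | ⟨-, rfl, -⟩
      · exact h.reach _ _ _ hx
      · obtain ⟨q, a, hq, -, hy⟩ := (h.dfa.trans_iff _ _ _).1 h2
        obtain ⟨w, hw⟩ := h.reach _ _ _ h1
        refine ⟨w ++ [a], ?_⟩
        have : q = M.eval w := Fin.ext (hq ▸ hw)
        rw [hy, M.eval_append_singleton, this]
    · simp [State.setTab, h.pairs]
    · simpa [State.setTab] using h.answer
  · exact h
  · exact h

theorem preserves_reachAnswer {P : ℕ → ℕ → ℕ → Prop} {A : Prop}
    (hA : ∀ w a, M.eval w ∉ M.accept → M.eval (w ++ [a]) ∈ M.accept → A) :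
    Preserves N reachAnswer (ReachInv M P A) := by
  refine Preserves.forAll (fun v hv => ReachInv.irrelevant (by
    constructor <;> rintro rfl <;> simp at hv)) fun s h => ?_
  simp only [when, eval]
  split_ifs with h1 h2 h3 h4
  · exact h
  · refine ⟨h.dfa.setTab (by simp) _ _ _, ?_, ?_, fun _ => ?_⟩
    · simpa [State.setTab] using h.reach
    · simp [State.setTab, h.pairs]
    · obtain ⟨q, a, hq, -, hy⟩ := (h.dfa.trans_iff _ _ _).1 h2
      obtain ⟨w, hw⟩ := h.reach _ _ _ h1
      have : q = M.eval w := Fin.ext (hq ▸ hw)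
      rw [h.dfa.null_eq, h.dfa.final_iff] at h3 h4
      refine hA w a (fun hc => h3 ⟨_, hc, hw⟩) ?_
      obtain ⟨q', hq', hyq⟩ := h4
      rw [M.eval_append_singleton, ← this]
      have : M.step q a = q' := Fin.ext (hy ▸ hyq)
      rwa [this]
  all_goals exact h

/-- The values of the loop registers in the iteration that is of interest. -/
def loopValues (i j l i' j' : ℕ) : Register → ℕ
  | x => i
  | y => j
  | letter => l
  | x' => i'
  | y' => j'
  | _ => 0

/-- Each pass extends the marks by at least one letter. As the table is changed during the pass,
more may be marked, which is harmless: soundness is the matter of `ReachInv`. -/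
theorem reach_iterate (hn : n ≤ N) (hk : k ≤ N) (hs : HasDFA M s)
    (h0 : s.tab reach M.start 0 0) (j : ℕ) (w : List (Fin k)) (hw : w.length ≤ j) :
    ((reachStep.eval N)^[j] s).tab reach (M.eval w) 0 0 := by
  have hdfa : Preserves N reachStep (HasDFA M) := by
    refine Preserves.forAll (fun v hv s m h => h.setReg (by
      constructor <;> rintro rfl <;> simp at hv) m) fun s h => ?_
    simp only [when, eval]
    split_ifs
    · exact h.setTab (by simp) _ _ _
    all_goals exact h
  induction j generalizing w with
  | zero =>
    obtain rfl : w = [] := List.length_eq_zero_iff.1 (by omega)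
    exact h0
  | succ j ih =>
    rw [iterate_succ_apply']
    induction w using List.reverseRecOn with
    | nil => exact preserves_tab _ _ _ _ _ _ (ih [] (Nat.zero_le _))
    | append_singleton w a _ =>
      have hwj : w.length ≤ j := by simpa using hw
      -- The iteration that matters is the one whose loop registers hold the last transition on `w
      -- ++ [a]`.
      refine forAll_hit (by simp) (fun s => ?_)
        (I := fun s => HasDFA M s ∧ s.tab reach (M.eval w) 0 0)
        (fun v hv s m h => ⟨h.1.setReg (by constructor <;> rintro rfl <;> simp at hv) m, h.2⟩)
        (fun s h => ⟨?_, preserves_tab _ _ _ _ _ s h.2⟩) (fun v hv s m h => h)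
        (preserves_tab _ _ _ _ _) (f := loopValues (M.eval w) (M.eval (w ++ [a])) a 0 0) ?_
        (fun s h hf => ?_) ⟨hdfa.iterate j hs, ih w hwj⟩
      · simp only [when, eval]
        split_ifs <;> rfl
      · simp only [when, eval]
        split_ifs
        · exact h.1.setTab (by simp) _ _ _
        all_goals exact h.1
      · simp only [List.mem_cons, List.not_mem_nil, or_false, forall_eq_or_imp, forall_eq,
          loopValues]
        omega
      · simp only [List.mem_cons, List.not_mem_nil, or_false, forall_eq_or_imp, forall_eq,
          loopValues] at hf
        have ht : s.tab trans (M.eval w) a (M.eval (w ++ [a])) :=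
          (h.1.trans_iff _ _ _).2 ⟨M.eval w, a, rfl, rfl, by rw [M.eval_append_singleton]⟩
        simp only [when, eval, hf, h.1.null_eq, h.2, ht, if_true]
        simp [State.setTab]

/-- `A` stands for an answer that was given before. Together with the preservation of the automaton
and of `pairs`, this form allows `decideSuffix` to be run afterwards on the resulting state. -/
theorem eval_decidePrefix (hn : n ≤ N) (hk : k ≤ N) (hs : HasDFA M s)
    (hreach : ∀ x y z, ¬ s.tab reach x y z) {A : Prop} (hA : A ↔ s.tab answer 0 0 0) :
    HasDFA M (decidePrefix.eval N s) ∧ (decidePrefix.eval N s).tab pairs = s.tab pairs ∧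
      ((decidePrefix.eval N s).tab answer 0 0 0 ↔ A ∨ ¬ IsPrefixClosed M.accepts) := by
  set s₁ := (Cmd.set reach start null null).eval N s with hs₁
  set s₂ := (Cmd.loop reachStep).eval N s₁ with hs₂
  have hs₃ : decidePrefix.eval N s = reachAnswer.eval N s₂ := rfl
  have h₁ : ReachInv M (s.tab pairs) (A ∨ ¬ IsPrefixClosed M.accepts) s₁ := by
    refine ⟨hs.setTab (by simp) _ _ _, fun x y z hx => ⟨[], ?_⟩, ?_, ?_⟩
    · rcases hx with hx | ⟨-, rfl, -⟩
      · exact absurd hx (hreach _ _ _)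
      · exact hs.start_eq
    · simp [hs₁, eval, State.setTab]
    · intro h
      left
      simpa [hs₁, eval, State.setTab, hA] using h
  have h₂ : ReachInv M _ _ s₂ := preserves_reachStep.loop _ h₁
  have h₃ : ReachInv M _ _ (reachAnswer.eval N s₂) := preserves_reachAnswer (fun w a hw hwa =>
    Or.inr ((not_isPrefixClosed_accepts_iff M).2 ⟨w, a, hw, hwa⟩)) _ h₂
  rw [hs₃]
  refine ⟨h₃.dfa, h₃.pairs, h₃.answer, ?_⟩
  rintro (h | h)
  · refine preserves_tab _ _ _ _ _ _ (preserves_tab _ _ _ _ _ _ (Or.inl (hA.1 h)))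
  · obtain ⟨w, a, hw, hwa⟩ := (not_isPrefixClosed_accepts_iff M).1 h
    -- A word of length at most `n ≤ N` reaches the same state, so `N` passes have marked it.
    obtain ⟨w', hw', he⟩ := exists_short_evalFrom_eq M M.start w
    have he' : M.eval w' = M.eval w := he
    rw [M.eval_append_singleton, ← he', ← M.eval_append_singleton] at hwa
    rw [← he'] at hw
    have hr : s₂.tab reach (M.eval w') 0 0 :=
      reach_iterate hn hk h₁.dfa (by simp [hs₁, eval, State.setTab, hs.start_eq, hs.null_eq]) N w'
        (hw'.trans (by simpa using hn))
    refine forAll_hit (by simp) (fun s => ?_)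
      (I := fun s => HasDFA M s ∧ s.tab reach (M.eval w') 0 0)
      (fun v hv s m h => ⟨h.1.setReg (by constructor <;> rintro rfl <;> simp at hv) m, h.2⟩)
      (fun s h => ⟨?_, preserves_tab _ _ _ _ _ s h.2⟩) (fun v hv s m h => h)
      (preserves_tab _ _ _ _ _) (f := loopValues (M.eval w') (M.eval (w' ++ [a])) a 0 0) ?_
      (fun s h hf => ?_) ⟨h₂.dfa, hr⟩
    · simp only [when, eval]
      split_ifs <;> rfl
    · simp only [when, eval]
      split_ifs
      · exact h.1
      · exact h.1.setTab (by simp) _ _ _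
      all_goals exact h.1
    · simp only [List.mem_cons, List.not_mem_nil, or_false, forall_eq_or_imp, forall_eq,
        loopValues]
      omega
    · simp only [List.mem_cons, List.not_mem_nil, or_false, forall_eq_or_imp, forall_eq,
        loopValues] at hf
      have ht : s.tab trans (M.eval w') a (M.eval (w' ++ [a])) :=
        (h.1.trans_iff _ _ _).2 ⟨M.eval w', a, rfl, rfl, by rw [M.eval_append_singleton]⟩
      have hf1 : ¬ s.tab final (M.eval w') 0 0 := by
        rw [h.1.final_iff]
        rintro ⟨q, hq, he⟩
        exact hw (Fin.ext he ▸ hq)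
      have hf2 : s.tab final (M.eval (w' ++ [a])) 0 0 := (h.1.final_iff _).2 ⟨_, hwa, rfl⟩
      simp only [when, eval, hf, h.1.null_eq, h.2, ht, hf1, hf2, if_true, if_false]
      simp [State.setTab]

/-- Mark the pairs of the state after one letter and the start state. -/
def pairsInit : Cmd Register Table := forAll [letter, x]
  (when trans start letter x (.set pairs x start null))

/-- Mark the successors of the marked pairs. -/
def pairsStep : Cmd Register Table := forAll [x, y, letter, x', y']
  (when pairs x y null (when trans x letter x' (when trans y letter y' (.set pairs x' y' null))))

/-- Search a marked pair of a final state and a state that is not final. -/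
def pairsAnswer : Cmd Register Table := forAll [x, y]
  (when pairs x y null (when final x null null
    (.ifTab final y null null .skip (.set answer null null null))))

/-- Decide whether the language of an automaton is not suffix-closed. -/
def decideSuffix : Cmd Register Table :=
  .seq pairsInit (.seq (.loop (.loop pairsStep)) pairsAnswer)

/-- The marked pairs are reached by words that differ by a first letter, and the answer is correct
if it is positive. -/
structure PairsInv (M : DFA (Fin k) (Fin n)) (A : Prop) (s : State Register Table) : Prop where
  dfa : HasDFA M s
  pairs : ∀ x y z, s.tab pairs x y z →
    ∃ w a, x = M.evalFrom (M.step M.start a) w ∧ y = M.eval w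
  answer : s.tab answer 0 0 0 → A

theorem PairsInv.irrelevant {A : Prop} {r : Register}
    (hr : r ≠ null ∧ r ≠ start) : Irrelevant r (PairsInv M A) :=
  fun _ m h => ⟨h.dfa.setReg hr m, h.pairs, h.answer⟩

theorem preserves_pairsInit {A : Prop} : Preserves N pairsInit (PairsInv M A) := by
  refine Preserves.forAll (fun v hv => PairsInv.irrelevant (by
    constructor <;> rintro rfl <;> simp at hv)) fun s h => ?_
  simp only [when, eval]
  split_ifs with h1
  · refine ⟨h.dfa.setTab (by simp) _ _ _, fun x y z hx => ?_, ?_⟩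
    · rcases hx with hx | ⟨-, rfl, rfl, -⟩
      · exact h.pairs _ _ _ hx
      · obtain ⟨q, a, hq, -, hy⟩ := (h.dfa.trans_iff _ _ _).1 h1
        have : q = M.start := Fin.ext (hq ▸ h.dfa.start_eq)
        exact ⟨[], a, by rw [hy, this]; rfl, h.dfa.start_eq⟩
    · simpa [State.setTab] using h.answer
  · exact h

theorem preserves_pairsStep {A : Prop} : Preserves N pairsStep (PairsInv M A) := by
  refine Preserves.forAll (fun v hv => PairsInv.irrelevant (by
    constructor <;> rintro rfl <;> simp at hv)) fun s h => ?_
  simp only [when, eval]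
  split_ifs with h1 h2 h3
  · refine ⟨h.dfa.setTab (by simp) _ _ _, fun x y z hx => ?_, ?_⟩
    · rcases hx with hx | ⟨-, rfl, rfl, -⟩
      · exact h.pairs _ _ _ hx
      · obtain ⟨q, a, hq, ha, hy⟩ := (h.dfa.trans_iff _ _ _).1 h2
        obtain ⟨q', a', hq', ha', hy'⟩ := (h.dfa.trans_iff _ _ _).1 h3
        obtain ⟨w, b, hw, hw'⟩ := h.pairs _ _ _ h1
        have e1 : q = M.evalFrom (M.step M.start b) w := Fin.ext (hq ▸ hw)
        have e2 : q' = M.eval w := Fin.ext (hq' ▸ hw')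
        -- Both transitions are looked up with the same register `letter`, so the two runs read the
        -- same word.
        have e3 : a' = a := Fin.ext (ha' ▸ ha)
        refine ⟨w ++ [a], b, ?_, ?_⟩
        · rw [hy, M.evalFrom_append_singleton, e1]
        · rw [hy', M.eval_append_singleton, e2, e3]
    · simpa [State.setTab] using h.answer
  all_goals exact h

theorem preserves_pairsAnswer {A : Prop}
    (hA : ∀ w a, M.evalFrom (M.step M.start a) w ∈ M.accept → M.eval w ∉ M.accept → A) :
    Preserves N pairsAnswer (PairsInv M A) := by
  refine Preserves.forAll (fun v hv => PairsInv.irrelevant (by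
    constructor <;> rintro rfl <;> simp at hv)) fun s h => ?_
  simp only [when, eval]
  split_ifs with h1 h2 h3
  · exact h
  · refine ⟨h.dfa.setTab (by simp) _ _ _, ?_, fun _ => ?_⟩
    · simpa [State.setTab] using h.pairs
    · obtain ⟨w, b, hw, hw'⟩ := h.pairs _ _ _ h1
      rw [h.dfa.null_eq, h.dfa.final_iff] at h2 h3
      refine hA w b ?_ (fun hc => h3 ⟨_, hc, hw'⟩)
      obtain ⟨q, hq, he⟩ := h2
      have : q = M.evalFrom (M.step M.start b) w := Fin.ext (he ▸ hw)
      rwa [← this]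
  all_goals exact h

/-- As in `reach_iterate`, but for the product automaton, starting from the pair that belongs to the
deleted first letter `b`. -/
theorem pairs_iterate (hn : n ≤ N) (hk : k ≤ N) (hs : HasDFA M s) (b : Fin k)
    (h0 : s.tab pairs (M.step M.start b) M.start 0) (j : ℕ) (w : List (Fin k))
    (hw : w.length ≤ j) :
    ((pairsStep.eval N)^[j] s).tab pairs (M.evalFrom (M.step M.start b) w) (M.eval w) 0 := by
  have hdfa : Preserves N pairsStep (HasDFA M) := by
    refine Preserves.forAll (fun v hv s m h => h.setReg (by
      constructor <;> rintro rfl <;> simp at hv) m) fun s h => ?_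
    simp only [when, eval]
    split_ifs
    · exact h.setTab (by simp) _ _ _
    all_goals exact h
  induction j generalizing w with
  | zero =>
    obtain rfl : w = [] := List.length_eq_zero_iff.1 (by omega)
    exact h0
  | succ j ih =>
    rw [iterate_succ_apply']
    induction w using List.reverseRecOn with
    | nil => exact preserves_tab _ _ _ _ _ _ (ih [] (Nat.zero_le _))
    | append_singleton w a _ =>
      have hwj : w.length ≤ j := by simpa using hw
      refine forAll_hit (by simp) (fun s => ?_)
        (I := fun s => HasDFA M s ∧
          s.tab pairs (M.evalFrom (M.step M.start b) w) (M.eval w) 0)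
        (fun v hv s m h => ⟨h.1.setReg (by constructor <;> rintro rfl <;> simp at hv) m, h.2⟩)
        (fun s h => ⟨?_, preserves_tab _ _ _ _ _ s h.2⟩) (fun v hv s m h => h)
        (preserves_tab _ _ _ _ _) (f := loopValues (M.evalFrom (M.step M.start b) w) (M.eval w) a
          (M.evalFrom (M.step M.start b) (w ++ [a])) (M.eval (w ++ [a]))) ?_
        (fun s h hf => ?_) ⟨hdfa.iterate j hs, ih w hwj⟩
      · simp only [when, eval]
        split_ifs <;> rfl
      · simp only [when, eval]
        split_ifs
        · exact h.1.setTab (by simp) _ _ _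
        all_goals exact h.1
      · simp only [List.mem_cons, List.not_mem_nil, or_false, forall_eq_or_imp, forall_eq,
          loopValues]
        omega
      · simp only [List.mem_cons, List.not_mem_nil, or_false, forall_eq_or_imp, forall_eq,
          loopValues] at hf
        have ht : s.tab trans (M.eval w) a (M.eval (w ++ [a])) :=
          (h.1.trans_iff _ _ _).2 ⟨M.eval w, a, rfl, rfl, by rw [M.eval_append_singleton]⟩
        have ht' : s.tab trans (M.evalFrom (M.step M.start b) w) a
            (M.evalFrom (M.step M.start b) (w ++ [a])) :=
          (h.1.trans_iff _ _ _).2 ⟨_, a, rfl, rfl, by rw [M.evalFrom_append_singleton]⟩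
        simp only [when, eval, hf, h.1.null_eq, h.2, ht, ht', if_true]
        simp [State.setTab]

theorem eval_decideSuffix (hn : n ≤ N) (hk : k ≤ N) (hs : HasDFA M s)
    (hpairs : ∀ x y z, ¬ s.tab pairs x y z) {A : Prop} (hA : A ↔ s.tab answer 0 0 0) :
    (decideSuffix.eval N s).tab answer 0 0 0 ↔ A ∨ ¬ IsSuffixClosed M.accepts := by
  set s₁ := pairsInit.eval N s with hs₁
  set s₂ := (Cmd.loop (.loop pairsStep)).eval N s₁ with hs₂
  have hs₃ : decideSuffix.eval N s = pairsAnswer.eval N s₂ := rfl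
  have h₀ : PairsInv M (A ∨ ¬ IsSuffixClosed M.accepts) s :=
    ⟨hs, fun x y z h => absurd h (hpairs x y z), fun h => Or.inl (hA.2 h)⟩
  have h₁ : PairsInv M _ s₁ := preserves_pairsInit _ h₀
  have h₂ : PairsInv M _ s₂ := preserves_pairsStep.loop.loop _ h₁
  have h₃ : PairsInv M _ (pairsAnswer.eval N s₂) := preserves_pairsAnswer (fun w a hw hwa =>
    Or.inr ((not_isSuffixClosed_accepts_iff M).2 ⟨w, a, hw, hwa⟩)) _ h₂
  rw [hs₃]
  refine ⟨h₃.answer, ?_⟩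
  rintro (h | h)
  · exact preserves_tab _ _ _ _ _ _ (preserves_tab _ _ _ _ _ _
      (preserves_tab _ _ _ _ _ _ (hA.1 h)))
  · obtain ⟨w, b, hw, hwb⟩ := (not_isSuffixClosed_accepts_iff M).1 h
    -- Shortening in the product automaton keeps the ends of both runs at once, at the price of the
    -- bound `n * n`.
    obtain ⟨w', hw', he⟩ := exists_short_evalFrom_eq (pairDFA M) (M.step M.start b, M.start) w
    rw [evalFrom_pairDFA, evalFrom_pairDFA, Prod.mk.injEq] at he
    obtain ⟨he, he'⟩ := he
    change M.evalFrom M.start w ∉ _ at hwb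
    rw [← he] at hw
    rw [← he'] at hwb
    change M.eval w' ∉ _ at hwb
    have hinit : s₁.tab pairs (M.step M.start b) M.start 0 := by
      refine forAll_hit (by simp) (fun s => ?_) (I := HasDFA M)
        (fun v hv s m h => h.setReg (by constructor <;> rintro rfl <;> simp at hv) m)
        (fun s h => ?_) (fun v hv s m h => h)
        (preserves_tab _ _ _ _ _) (f := loopValues (M.step M.start b) 0 b 0 0) ?_
        (fun s h hf => ?_) hs
      · simp only [when, eval]
        split_ifs <;> rfl
      · simp only [when, eval]
        split_ifs
        · exact h.setTab (by simp) _ _ _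
        · exact h
      · simp only [List.mem_cons, List.not_mem_nil, or_false, forall_eq_or_imp, forall_eq,
          loopValues]
        omega
      · simp only [List.mem_cons, List.not_mem_nil, or_false, forall_eq_or_imp, forall_eq,
          loopValues] at hf
        have ht : s.tab trans M.start b (M.step M.start b) :=
          (h.trans_iff _ _ _).2 ⟨M.start, b, rfl, rfl, rfl⟩
        simp only [when, eval, hf, h.null_eq, h.start_eq, ht, if_true]
        simp [State.setTab]
    have hr : s₂.tab pairs (M.evalFrom (M.step M.start b) w') (M.eval w') 0 := by
      -- The doubled loop makes `N * N` passes, enough for words of length `n * n`.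
      have : s₂ = (pairsStep.eval N)^[N * N] s₁ := by
        rw [Function.iterate_mul]
        rfl
      rw [this]
      refine pairs_iterate hn hk h₁.dfa b hinit _ w' (hw'.trans ?_)
      simpa using Nat.mul_le_mul hn hn
    refine forAll_hit (by simp) (fun s => ?_)
      (I := fun s => HasDFA M s ∧
        s.tab pairs (M.evalFrom (M.step M.start b) w') (M.eval w') 0)
      (fun v hv s m h => ⟨h.1.setReg (by constructor <;> rintro rfl <;> simp at hv) m, h.2⟩)
      (fun s h => ⟨?_, preserves_tab _ _ _ _ _ s h.2⟩) (fun v hv s m h => h)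
      (preserves_tab _ _ _ _ _)
      (f := loopValues (M.evalFrom (M.step M.start b) w') (M.eval w') 0 0 0) ?_
      (fun s h hf => ?_) ⟨h₂.dfa, hr⟩
    · simp only [when, eval]
      split_ifs <;> rfl
    · simp only [when, eval]
      split_ifs
      · exact h.1
      · exact h.1.setTab (by simp) _ _ _
      all_goals exact h.1
    · simp only [List.mem_cons, List.not_mem_nil, or_false, forall_eq_or_imp, forall_eq,
        loopValues]
      omega
    · simp only [List.mem_cons, List.not_mem_nil, or_false, forall_eq_or_imp, forall_eq,
        loopValues] at hf
      have hf1 : ¬ s.tab final (M.eval w') 0 0 := by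
        rw [h.1.final_iff]
        rintro ⟨q, hq, he⟩
        exact hwb (Fin.ext he ▸ hq)
      have hf2 : s.tab final (M.evalFrom (M.step M.start b) w') 0 0 :=
        (h.1.final_iff _).2 ⟨_, hw, rfl⟩
      simp only [when, eval, hf, h.1.null_eq, h.2, hf1, hf2, if_true, if_false]
      simp [State.setTab]

theorem le_length_encode (M : FiniteDFA) :
    M.numStates ≤ M.encode.length ∧ M.numLetters ≤ M.encode.length := by
  simp only [FiniteDFA.encode, unary, List.length_append, List.length_replicate]
  omega

theorem polyTimeDecidable_not_isPrefixClosed :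
    PolyTimeDecidable FiniteDFA.encode fun M => ¬ IsPrefixClosed M.lang := by
  refine polyTimeDecidable (.seq readDFA decidePrefix) input answer fun M => ?_
  obtain ⟨h1, h2, -, h4⟩ := eval_readDFA M rfl
  obtain ⟨hn, hk⟩ := le_length_encode M
  rw [eval_seq, (eval_decidePrefix hn hk h1 h2 Iff.rfl).2.2, or_iff_right (h4 0 0 0)]
  rfl

theorem polyTimeDecidable_not_isSuffixClosed :
    PolyTimeDecidable FiniteDFA.encode fun M => ¬ IsSuffixClosed M.lang := by
  refine polyTimeDecidable (.seq readDFA decideSuffix) input answer fun M => ?_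
  obtain ⟨h1, -, h3, h4⟩ := eval_readDFA M rfl
  obtain ⟨hn, hk⟩ := le_length_encode M
  rw [eval_seq, eval_decideSuffix hn hk h1 h3 Iff.rfl, or_iff_right (h4 0 0 0)]
  rfl

/-- Both searches write to the same table `answer`, so running them in succession decides the
disjunction. -/
theorem polyTimeDecidable_not_isFactorial :
    PolyTimeDecidable FiniteDFA.encode fun M => ¬ IsFactorial M.lang := by
  refine polyTimeDecidable (.seq readDFA (.seq decidePrefix decideSuffix)) input answer
    fun M => ?_
  obtain ⟨h1, h2, h3, h4⟩ := eval_readDFA M rfl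
  obtain ⟨hn, hk⟩ := le_length_encode M
  obtain ⟨g1, g2, g3⟩ := eval_decidePrefix hn hk h1 h2 Iff.rfl
  rw [or_iff_right (h4 0 0 0)] at g3
  rw [eval_seq, eval_seq, eval_decideSuffix hn hk g1 (by rwa [g2]) g3.symm, isFactorial_iff,
    not_and_or]
  rfl

end StackProgram

theorem mainTheorem10 :
    DFAClosure.PolyTimeDecidable DFAClosure.FiniteDFA.encode
        (fun M => ¬ DFAClosure.IsPrefixClosed M.lang) ∧
      DFAClosure.PolyTimeDecidable DFAClosure.FiniteDFA.encode
        (fun M => ¬ DFAClosure.IsSuffixClosed M.lang) ∧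
      DFAClosure.PolyTimeDecidable DFAClosure.FiniteDFA.encode
        (fun M => ¬ DFAClosure.IsFactorial M.lang) :=
  ⟨StackProgram.polyTimeDecidable_not_isPrefixClosed,
    StackProgram.polyTimeDecidable_not_isSuffixClosed,
    StackProgram.polyTimeDecidable_not_isFactorial⟩
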